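/- Let $(R,\mathfrak m,k)$ be a one-dimensional Noetherian local domain with infinite residue field $k$ and quotient field $K$. Assume that the integral closure $\overline R$ of $R$ in $K$ is a finite $R$-module and a discrete valuation ring with valuation $v$, and that the natural map $k\to\overline R/t\overline R$ ($t$ a uniformizer) is an isomorphism. Write $\ell$ for length over $R$; for $R$-submodules $L,N$ of $K$ put $L:N=\{z\in K\mid zN\subseteq L\}$ and $L^{*}=R:L$. Let $\gamma_R=R:\overline R$, $c=\ell(\overline R/\gamma_R)$, $n=\ell(R/\gamma_R)$; let $0=s_0<s_1<\cdots$ be the elements of the semigroup $v(R\setminus\{0\})$, let $R_i=\{a\in R\mid v(a)\ge s_i\}$ and $r_i=\ell\big((R:R_i)/(R:R_{i-1})\big)$ for $1\le i\le n$. Assume that $R$ is almost Gorenstein, that is, its type sequence $[r_1,\dots,r_n]$ is $[r,1,\dots,1]$, where $r=r_1$ is the Cohen–Macaulay type. Let $\omega$ be a canonical ideal of $R$ (a nonzero fractional ideal with $\omega:(\omega:J)=J$ for all nonzero fractional ideals $J$), normalized by $R\subseteq\omega\subseteq\overline R$; such an $\omega$ exists. Let $I$ be an $\mathfrak m$-primary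 ideal of $R$ that is not principal, let $h_I(z)\in\mathbb Z[z]$ be the polynomial with $\sum_{j\ge0}\ell(I^j/I^{j+1})z^j=h_I(z)/(1-z)$, and let $e=h_I(1)$ and $\rho=h_I'(1)$ be the multiplicity and the genus of $I$. Let $x\in I$ be a minimal reduction of $I$, that is, $I^{j+1}=xI^j$ for all large $j$ (such an $x$ exists), and let $\nu$ be the reduction exponent: the least integer with $I^{j+1}=xI^j$ for all $j\ge\nu$. Let $\Lambda=\bigcup_{j\ge0}(I^j:I^j)$ be the blowing-up of $R$ along $I$, and $c_\Lambda=\ell(\overline R/(\Lambda:\overline R))$. All the lengths occurring here are finite, and: 1. $2\rho=e\nu+r-1-\ell\big((R:\Lambda)/I^\nu\big)-\ell(\Lambda^{**}/\Lambda)$; in particular $2\rho\le e\nu+r-1$. 2. The following conditions are equivalent: (a) $2\rho=e\nu+r-1$; (b) $\Lambda$ is Gorenstein and $c-c_\Lambda=e\nu$; (c) $R:\Lambda=I^\nu$; (d) $\omega:\Lambda=I^\nu$. If they hold, then all of the following hold: $(A_1)$ $\omega\subseteq\Lambda$; $(A_2)$ $\omega\Lambda=\Lambda$; $(A_3)$ $\omega:\Lambda=R:\Lambda$;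 $(A_4)$ $I^j=I^j\omega\cap R$ for all $j\ge\nu$; $(A_5)$ $\omega I^j=I^j$ for all $j\ge\nu$; $(A_6)$ $\omega I^j=I^j$ for some $j>0$. -/

import Mathlib

open scoped nonZeroDivisors Polynomial PowerSeries

namespace CurveBlowup

noncomputable section

/-- The length `ℓ_R(L / N)` for submodules `N ⊆ L` of a module. -/
def len {R M : Type*} [CommRing R] [AddCommGroup M] [Module R M] (L N : Submodule R M) : ℕ∞ :=
  Module.length R (L ⧸ N.submoduleOf L)

section Hilbert

variable {R : Type*} [CommRing R]

/-- The Hilbert function `H_I(n) = ℓ_R(I^n / I^(n+1))`. -/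
def hilbertFn (I : Ideal R) (n : ℕ) : ℕ∞ := len (I ^ n) (I ^ (n + 1))

/-- The Hilbert-Poincaré series `P_I(z) = ∑ H_I(n) z^n`. -/
def hilbertSeries (I : Ideal R) : ℤ⟦X⟧ := PowerSeries.mk fun n => ((hilbertFn I n).toNat : ℤ)

/-- `p` is the `h`-polynomial of `I`: `P_I(z) = p(z) / (1 - z)`. -/
def IsHPolynomial (I : Ideal R) (p : ℤ[X]) : Prop :=
  (p : ℤ⟦X⟧) = (1 - PowerSeries.X) * hilbertSeries I

open Classical in
/-- The `h`-polynomial of `I` (there is at most one polynomial as in `IsHPolynomial`). -/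
def hPolynomial (I : Ideal R) : ℤ[X] :=
  if h : ∃ p : ℤ[X], IsHPolynomial I p then h.choose else 0

/-- The multiplicity `e(I) = h_I(1)`. -/
def idealMult (I : Ideal R) : ℤ := (hPolynomial I).eval 1

/-- The genus `ρ(I) = h_I'(1)`. -/
def genus (I : Ideal R) : ℤ := (Polynomial.derivative (hPolynomial I)).eval 1

/-- `x ∈ I` is a minimal reduction of `I`: `I^(n+1) = x I^n` for all large `n`. -/
def IsMinimalReduction (I : Ideal R) (x : R) : Prop :=
  x ∈ I ∧ ∃ m : ℕ, ∀ n ≥ m, I ^ (n + 1) = Ideal.span {x} * I ^ n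

/-- The reduction exponent: the least `m` with `I^(n+1) = x I^n` for all `n ≥ m`. -/
def reductionExponent (I : Ideal R) (x : R) : ℕ :=
  sInf {m : ℕ | ∀ n ≥ m, I ^ (n + 1) = Ideal.span {x} * I ^ n}

end Hilbert

section Fractional

variable {R : Type*} [CommRing R] (K : Type*) [Field K] [Algebra R K]

/-- An ideal of `R`, seen inside `K`. In `Submodule R K`, the quotient `L / N` is the colon
`L : N = {z ∈ K | z N ⊆ L}`, and `1` is `R`. -/
abbrev inK (I : Ideal R) : Submodule R K := IsLocalization.coeSubmodule K I

theorem colon_self_succ (L : Submodule R K) (n : ℕ) : L ^ n / L ^ n ≤ L ^ (n + 1) / L ^ (n + 1) := by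
  rw [Submodule.le_div_iff_mul_le, pow_succ, ← mul_assoc]
  exact mul_le_mul_left (Submodule.le_div_iff_mul_le.mp le_rfl) L

theorem colon_self_mono (L : Submodule R K) : Monotone fun n : ℕ => L ^ n / L ^ n :=
  monotone_nat_of_le_succ (colon_self_succ K L)

/-- The blowing-up `Λ(I) = ⋃ₙ (I^n : I^n)` of `R` along `I`, a ring between `R` and `K`. -/
def blowup (I : Ideal R) : Subalgebra R K where
  carrier := {z | ∃ n : ℕ, z ∈ inK K I ^ n / inK K I ^ n}
  mul_mem' := by
    rintro a b ⟨n, ha⟩ ⟨m, hb⟩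
    refine ⟨max n m, ?_⟩
    have ha' := colon_self_mono K (inK K I) (le_max_left n m) ha
    have hb' := colon_self_mono K (inK K I) (le_max_right n m) hb
    rw [Submodule.mem_div_iff_forall_mul_mem] at *
    intro y hy
    rw [mul_assoc]
    exact ha' _ (hb' y hy)
  add_mem' := by
    rintro a b ⟨n, ha⟩ ⟨m, hb⟩
    exact ⟨max n m, Submodule.add_mem _ (colon_self_mono K (inK K I) (le_max_left n m) ha)
      (colon_self_mono K (inK K I) (le_max_right n m) hb)⟩
  algebraMap_mem' := by
    intro r
    refine ⟨0, ?_⟩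
    rw [Submodule.mem_div_iff_forall_mul_mem]
    intro y hy
    rw [← Algebra.smul_def]
    exact Submodule.smul_mem _ r hy

/-- The blowing-up `Λ(I)` as an `R`-submodule of `K`. -/
abbrev blowupMod (I : Ideal R) : Submodule R K := Subalgebra.toSubmodule (blowup K I)

/-- The dual `L* = R : L`. -/
abbrev starDual (L : Submodule R K) : Submodule R K := 1 / L

variable (R)

/-- The integral closure of `R` in `K`, as a submodule of `K`. -/
abbrev normalization : Submodule R K := Subalgebra.toSubmodule (integralClosure R K)

/-- `W` is a canonical (fractional) ideal of `R`, in the sense of Herzog and Kunz: a nonzero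
fractional ideal with `W : (W : J) = J` for every nonzero fractional ideal `J`. -/
def IsCanonicalIdeal (W : Submodule R K) : Prop :=
  W ≠ ⊥ ∧ IsFractional R⁰ W ∧
    ∀ J : Submodule R K, J ≠ ⊥ → IsFractional R⁰ J → W / (W / J) = J

/-- A canonical ideal `ω`, normalized by `R ⊆ ω ⊆ R̄`. -/
def IsNormalizedCanonicalIdeal (W : Submodule R K) : Prop :=
  IsCanonicalIdeal R K W ∧ 1 ≤ W ∧ W ≤ normalization R K

/-- `R`, a one-dimensional Noetherian local domain with quotient field `K`, is Gorenstein: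
it is a canonical ideal of itself. -/
def IsGorenstein : Prop := IsCanonicalIdeal R K 1

/-- The conductor of `R` in `R̄`: `γ_R = R : R̄`. -/
def conductorIdeal : Submodule R K := 1 / normalization R K

/-- `c = ℓ_R(R̄ / γ_R)`. -/
def condLen : ℕ∞ := len (normalization R K) (conductorIdeal R K)

variable {R} in
/-- `c_Λ = ℓ_R(R̄ / γ_Λ)`, where `γ_Λ = Λ : R̄` and `Λ = Λ(I)`. -/
def condLenBlowup (I : Ideal R) : ℕ∞ :=
  len (normalization R K) (blowupMod K I / normalization R K)

variable {R} in
/-- The conditions (A₁)–(A₆) for the blowing-up `Λ` of `R` along `I`, with reduction exponent `ν`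
and canonical ideal `ω`, all of them together. In (A₄), `I^n ω ∩ R` is the canonical closure
of `I^n`. -/
structure ConditionsA (I : Ideal R) (ν : ℕ) (ω : Submodule R K) : Prop where
  a1 : ω ≤ blowupMod K I
  a2 : ω * blowupMod K I = blowupMod K I
  a3 : ω / blowupMod K I = 1 / blowupMod K I
  a4 : ∀ n ≥ ν, inK K (I ^ n) = inK K (I ^ n) * ω ⊓ 1
  a5 : ∀ n ≥ ν, ω * inK K (I ^ n) = inK K (I ^ n)
  a6 : ∃ n > 0, ω * inK K (I ^ n) = inK K (I ^ n)

variable [IsDiscreteValuationRing (integralClosure R K)]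

/-- The valuation of `R̄`, normalized by `v(t) = 1`, restricted to `R`. -/
def val (a : R) : ℕ∞ :=
  IsDiscreteValuationRing.addVal (integralClosure R K) (algebraMap R (integralClosure R K) a)

/-- The numerical semigroup `v(R)`. -/
def valueSemigroup : Set ℕ := {s | ∃ a : R, val R K a = s}

/-- The elements `s₀ = 0 < s₁ < s₂ < ⋯` of `v(R)` in increasing order. -/
def semigroupElt (i : ℕ) : ℕ := Nat.nth (· ∈ valueSemigroup R K) i

/-- The ideal `R_i = {a ∈ R | v(a) ≥ s_i}`. -/
def valIdeal (i : ℕ) : Ideal R where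
  carrier := {a | (semigroupElt R K i : ℕ∞) ≤ val R K a}
  zero_mem' := by simp [val]
  add_mem' := by
    intro a b ha hb
    simp only [Set.mem_ofPred_eq, val, map_add] at *
    exact le_trans (le_min ha hb) (AddValuation.map_add _ _ _)
  smul_mem' := by
    intro c a ha
    simp only [Set.mem_ofPred_eq, val, smul_eq_mul, map_mul] at *
    rw [AddValuation.map_mul]
    exact le_trans ha le_add_self

/-- The entry `r_i = ℓ_R((R : R_i) / (R : R_(i-1)))` of the type sequence `[r_1, …, r_n]`,
for `1 ≤ i ≤ n = ℓ_R(R / γ_R)`. -/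
def typeSeq (i : ℕ) : ℕ∞ :=
  len (1 / inK K (valIdeal R K i)) (1 / inK K (valIdeal R K (i - 1)))

/-- The Cohen-Macaulay type `r = r_1`. -/
def cmType : ℕ∞ := typeSeq R K 1

/-- `R` is almost Gorenstein: its type sequence is `[r_1, 1, …, 1]`. -/
def IsAlmostGorenstein : Prop :=
  ∀ i : ℕ, 2 ≤ i → (i : ℕ∞) ≤ len 1 (conductorIdeal R K) → typeSeq R K i = 1

end Fractional

end

end CurveBlowup

open CurveBlowup

/-
Let `d = x ^ ν`. Since `I ^ n = x ^ n Λ` for `n ≥ ν`, the Hilbert invariants are lengths of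
fractional ideals: `e ν = ℓ(Λ / dΛ)` and `ρ = ℓ(Λ / R)`.

The colon `ω : -` preserves lengths and `R : J = ω : ωJ`. The type sequence `[r, 1, …, 1]` gives
`ℓ(R̄ / R) = r - 1 + ℓ(R / γ_R)`, hence `ℓ(ω / R) = r - 1` and then `ω 𝔪 = 𝔪`. As `Λ ≠ R`, the ideal
`Λ* = R : Λ` lies in `𝔪`, so that `ω Λ* ⊆ R` and therefore `ω Λ* = Λ*`. Dualizing,
`ℓ(Λ** / R) = ℓ(ω / Λ*) = ℓ(R / Λ*) + r - 1`, and the formula for `2ρ` is additivity of length among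
`Λ**`, `Λ`, `R`, `Λ*` and `dΛ`.

Equality in `2ρ ≤ e ν + r - 1` thus means `Λ* = dΛ`; then `ω` fixes `dΛ`, so `ωΛ = Λ`, which gives
the conditions (A₁)–(A₆) and `ω : Λ = dΛ`. Finally `Λ` is local because `R̄` is, hence it is
Gorenstein if and only if `ω : Λ` is a principal fractional ideal `cΛ`; in that case
`c - c_Λ = ℓ(Λ / cΛ)`, which is `e ν` exactly when `cΛ = dΛ`.

An element of `I` of least value is a minimal reduction. If `γ_R = g R̄` and `t` is a uniformizer,
then `g / t` is a socle element of `K / R`, and a submodule of `K` maximal among those that contain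
`R` but not `g / t` is a normalized canonical ideal.
-/

namespace CurveBlowup

open scoped Pointwise

section Length

variable {R M M' : Type*} [CommRing R] [AddCommGroup M] [Module R M] [AddCommGroup M'] [Module R M']

theorem len_self (L : Submodule R M) : len L L = 0 := by
  rw [len, Module.length_eq_zero_iff, Submodule.Quotient.subsingleton_iff,
    Submodule.submoduleOf_self]

theorem len_eq_zero_iff {L N : Submodule R M} : len L N = 0 ↔ L ≤ N := by
  rw [len, Module.length_eq_zero_iff, Submodule.Quotient.subsingleton_iff,
    Submodule.submoduleOf_eq_top]

theorem len_eq_one_of_covBy {L N : Submodule R M} (h : N ⋖ L) : len L N = 1 :=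
  Module.length_eq_one_iff.mpr ((covBy_iff_quot_is_simple h.le).mp h)

theorem len_le_of_mem_iff (f : M →ₗ[R] M') {L N : Submodule R M} {L' N' : Submodule R M'}
    (hL : ∀ x ∈ L, f x ∈ L') (hN : ∀ x ∈ L, f x ∈ N' ↔ x ∈ N) : len L N ≤ len L' N' := by
  refine Module.length_le_of_injective (Submodule.mapQ (N.submoduleOf L) (N'.submoduleOf L')
    (f.restrict hL) fun x hx => (hN x x.2).mpr hx) ?_
  rw [← LinearMap.ker_eq_bot]
  exact Submodule.ker_liftQ_eq_bot _ _ _ fun x hx =>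
    (hN x x.2).mp ((Submodule.Quotient.mk_eq_zero (N'.submoduleOf L')).mp hx)

theorem len_add {A B C : Submodule R M} (hCB : C ≤ B) (hBA : B ≤ A) :
    len A C = len B C + len A B := by
  refine Module.length_eq_add_of_exact
    (Submodule.mapQ (C.submoduleOf B) (C.submoduleOf A) (Submodule.inclusion hBA) le_rfl)
    (Submodule.factor (Submodule.comap_mono hCB)) ?_ (Submodule.factor_surjective _) ?_
  · rw [← LinearMap.ker_eq_bot]
    exact Submodule.ker_liftQ_eq_bot _ _ _ fun x hx =>
      (Submodule.Quotient.mk_eq_zero (C.submoduleOf A)).mp hx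
  · intro z
    obtain ⟨z, rfl⟩ := Submodule.mkQ_surjective _ z
    constructor
    · intro hz
      have hzB : (z : M) ∈ B := (Submodule.Quotient.mk_eq_zero (B.submoduleOf A)).mp hz
      exact ⟨Submodule.Quotient.mk ⟨z, hzB⟩, rfl⟩
    · rintro ⟨y, hy⟩
      obtain ⟨y, rfl⟩ := Submodule.mkQ_surjective _ y
      rw [← hy]
      exact (Submodule.Quotient.mk_eq_zero (B.submoduleOf A)).mpr y.2

theorem len_mono {L L' N N' : Submodule R M} (hN : N' ≤ N) (h : N ≤ L) (hL : L ≤ L') :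
    len L N ≤ len L' N' := by
  rw [len_add (hN.trans h) hL, len_add hN h, add_assoc, add_left_comm]
  exact le_self_add

theorem len_map {f : M →ₗ[R] M'} (hf : Function.Injective f) (L N : Submodule R M) :
    len (L.map f) (N.map f) = len L N := by
  refine (LinearEquiv.length_eq (Submodule.Quotient.equiv _ _
    (Submodule.equivMapOfInjective f hf L) ?_)).symm
  ext ⟨y, hy⟩
  obtain ⟨x, hx, rfl⟩ := hy
  simp only [Submodule.submoduleOf, Submodule.mem_map, Submodule.mem_comap]
  constructor
  · rintro ⟨z, hz, hzx⟩
    exact ⟨z, hz, congrArg Subtype.val hzx⟩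
  · rintro ⟨z, hz, hzx⟩
    obtain rfl := hf hzx
    exact ⟨⟨z, hx⟩, hz, rfl⟩

theorem covBy_of_le_sup_span [IsLocalRing R] {L N : Submodule R M} {z : M} (hz : z ∈ L)
    (hzN : z ∉ N) (hNL : N ≤ L) (hm : ∀ a ∈ IsLocalRing.maximalIdeal R, a • z ∈ N)
    (h : L ≤ N ⊔ Submodule.span R {z}) : N ⋖ L := by
  refine ⟨lt_of_le_of_ne hNL (by rintro rfl; exact hzN hz), fun P hNP hPL => hPL.not_ge ?_⟩
  obtain ⟨y, hyP, hyN⟩ := SetLike.exists_of_lt hNP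
  obtain ⟨n, hn, w, hw, rfl⟩ := Submodule.mem_sup.mp (h (hPL.le hyP))
  obtain ⟨a, rfl⟩ := Submodule.mem_span_singleton.mp hw
  have ha : IsUnit a := by
    by_contra ha
    exact hyN (N.add_mem hn (hm a ha))
  have hzP : z ∈ P :=
    (P.smul_mem_iff_of_isUnit ha).mp ((P.add_mem_iff_right (hNP.le hn)).mp hyP)
  exact h.trans (sup_le hNP.le ((Submodule.span_singleton_le_iff_mem _ _).mpr hzP))

theorem smul_mem_of_covBy [IsLocalRing R] {A B : Submodule R M} (h : B ⋖ A) {a : R}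
    (ha : a ∈ IsLocalRing.maximalIdeal R) {y : M} (hy : y ∈ A) : a • y ∈ B := by
  have : IsSimpleModule R (A ⧸ B.submoduleOf A) := (covBy_iff_quot_is_simple h.le).mp h
  have hmax := IsLocalRing.eq_maximalIdeal
    (IsSimpleModule.annihilator_isMaximal (R := R) (M := A ⧸ B.submoduleOf A))
  rw [← hmax, Module.mem_annihilator] at ha
  exact (Submodule.Quotient.mk_eq_zero (B.submoduleOf A)).mp (ha (Submodule.Quotient.mk ⟨y, hy⟩))

theorem exists_le_covBy_of_fg {A B : Submodule R M} (hA : A.FG) (h : B < A) :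
    ∃ C, B ≤ C ∧ C ⋖ A := by
  have := Module.Finite.iff_fg.mpr hA
  obtain ⟨D, hD, hBD⟩ := (eq_top_or_exists_le_coatom (B.submoduleOf A)).resolve_left
    (mt Submodule.submoduleOf_eq_top.mp h.not_ge)
  refine ⟨D.map A.subtype, ?_, Set.Iic.isCoatom_iff.mp
    ((OrderIso.isCoatom_iff (Submodule.mapIic A) D).mpr hD)⟩
  simpa only [Submodule.submoduleOf, Submodule.map_comap_subtype, inf_eq_right.mpr h.le]
    using Submodule.map_mono (f := A.subtype) hBD

end Length

section Colon

variable {R A : Type*} [CommSemiring R] [CommSemiring A] [Algebra R A]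

theorem colon_mul (L M N : Submodule R A) : L / (M * N) = L / M / N := by
  refine eq_of_forall_le_iff fun D => ?_
  rw [Submodule.le_div_iff_mul_le, Submodule.le_div_iff_mul_le, Submodule.le_div_iff_mul_le,
    mul_assoc, mul_comm N M]

theorem colon_mul_le (L M : Submodule R A) : L / M * M ≤ L :=
  Submodule.le_div_iff_mul_le.mp le_rfl

theorem colon_mono {L L' M M' : Submodule R A} (hL : L ≤ L') (hM : M' ≤ M) : L / M ≤ L' / M' :=
  Submodule.le_div_iff_mul_le.mpr ((mul_le_mul' le_rfl hM).trans ((colon_mul_le L M).trans hL))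

theorem le_colon_colon (L M : Submodule R A) : M ≤ L / (L / M) := by
  rw [Submodule.le_div_iff_mul_le, mul_comm]
  exact colon_mul_le L M

theorem colon_one (L : Submodule R A) : L / 1 = L := by
  refine eq_of_forall_le_iff fun D => ?_
  rw [Submodule.le_div_iff_mul_le, mul_one]

variable {K : Type*} [Field K] [Algebra R K] {d : K}

theorem smul_colon (hd : d ≠ 0) (L M : Submodule R K) : d • L / M = d • (L / M) := by
  ext z
  simp only [Submodule.mem_div_iff_forall_mul_mem, Submodule.mem_smul_iff_inv_mul_mem hd, mul_assoc]

theorem colon_smul (hd : d ≠ 0) (L M : Submodule R K) : L / d • M = d⁻¹ • (L / M) := by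
  ext z
  simp only [Submodule.mem_div_iff_forall_mul_mem,
    Submodule.mem_smul_iff_inv_mul_mem (inv_ne_zero hd), inv_inv]
  constructor
  · intro h y hy
    rw [mul_comm d, mul_assoc]
    exact h _ (Submodule.smul_mem_pointwise_smul y d M hy)
  · intro h y hy
    have := h _ ((Submodule.mem_smul_iff_inv_mul_mem hd).mp hy)
    rwa [mul_mul_mul_comm, mul_inv_cancel₀ hd, one_mul] at this

end Colon

section InK

variable {R K : Type*} [CommRing R] [Field K] [Algebra R K]

theorem inK_top : inK K (⊤ : Ideal R) = 1 := IsLocalization.coeSubmodule_top K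

theorem inK_mul (I J : Ideal R) : inK K (I * J) = inK K I * inK K J :=
  IsLocalization.coeSubmodule_mul K I J

theorem inK_mono {I J : Ideal R} (h : I ≤ J) : inK K I ≤ inK K J :=
  IsLocalization.coeSubmodule_mono K h

theorem inK_le_one (I : Ideal R) : inK K I ≤ 1 := inK_top (R := R) (K := K) ▸ inK_mono le_top

theorem inK_pow (I : Ideal R) (n : ℕ) : inK K (I ^ n) = inK K I ^ n := by
  induction n with
  | zero => rw [pow_zero, pow_zero, Ideal.one_eq_top, inK_top]
  | succ n ih => rw [pow_succ, pow_succ, inK_mul, ih]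

theorem inK_span_mul (x : R) (I : Ideal R) :
    inK K (Ideal.span {x} * I) = algebraMap R K x • inK K I := by
  rw [inK_mul, inK, IsLocalization.coeSubmodule_span_singleton, ← Submodule.smul_one_eq_span,
    smul_mul_assoc, one_mul]

variable [IsFractionRing R K]

theorem mem_inK {I : Ideal R} {a : R} : algebraMap R K a ∈ inK K I ↔ a ∈ I := by
  rw [IsLocalization.mem_coeSubmodule]
  exact ⟨fun ⟨y, hy, h⟩ => IsFractionRing.injective R K h ▸ hy, fun h => ⟨a, h, rfl⟩⟩

theorem len_inK (I J : Ideal R) : len (inK K I) (inK K J) = len I J :=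
  len_map (f := Algebra.linearMap R K) (IsFractionRing.injective R K) I J

end InK

section Fractional

variable {R K : Type*} [CommRing R] [Field K] [Algebra R K]

variable (R K) in
/-- `J` is a nonzero fractional ideal of `R`: the modules to which colon duality and finiteness of
length apply. It is a predicate on submodules of `K`, where the colon is the division. -/
def IsNonzeroFractional (J : Submodule R K) : Prop := J ≠ ⊥ ∧ IsFractional R⁰ J

namespace IsNonzeroFractional

variable {A B C : Submodule R K} {d : K}

theorem of_le (hA : IsNonzeroFractional R K A) (hC : IsNonzeroFractional R K C) (hAB : A ≤ B)
    (hBC : B ≤ C) : IsNonzeroFractional R K B := by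
  obtain ⟨a, ha, h⟩ := hC.2
  exact ⟨ne_bot_of_le_ne_bot hA.1 hAB, a, ha, fun b hb => h b (hBC hb)⟩

theorem exists_smul_one_le (hA : IsNonzeroFractional R K A) : ∃ d : K, d ≠ 0 ∧ d • 1 ≤ A := by
  obtain ⟨d, hd, h⟩ := Submodule.exists_mem_ne_zero_of_ne_bot hA.1
  exact ⟨d, h, by rwa [Submodule.smul_one_eq_span, Submodule.span_singleton_le_iff_mem]⟩

theorem mul (hA : IsNonzeroFractional R K A) (hB : IsNonzeroFractional R K B) :
    IsNonzeroFractional R K (A * B) :=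
  ⟨by rw [Ne, Submodule.mul_eq_bot, not_or]; exact ⟨hA.1, hB.1⟩, hA.2.mul hB.2⟩

variable [IsFractionRing R K]

theorem smul_one (hd : d ≠ 0) : IsNonzeroFractional R K (d • (1 : Submodule R K)) := by
  rw [Submodule.smul_one_eq_span]
  exact ⟨by simpa only [Ne, Submodule.span_singleton_eq_bot],
    FractionalIdeal.isFractional_span_singleton (S := R⁰) d⟩

theorem one : IsNonzeroFractional R K 1 := by
  simpa only [one_smul] using smul_one (R := R) (one_ne_zero (α := K))

theorem smul (hd : d ≠ 0) (hA : IsNonzeroFractional R K A) : IsNonzeroFractional R K (d • A) := by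
  simpa only [smul_mul_assoc, one_mul] using (smul_one hd).mul hA

theorem inK {I : Ideal R} (hI : I ≠ ⊥) : IsNonzeroFractional R K (inK K I) :=
  ⟨fun h => hI (IsFractionRing.coeSubmodule_injective R K
      (h.trans (IsLocalization.coeSubmodule_bot K).symm)),
    FractionalIdeal.isFractional_of_le_one _ (inK_le_one I)⟩

variable [IsDomain R]

theorem exists_le_smul_one (hA : IsNonzeroFractional R K A) : ∃ d : K, d ≠ 0 ∧ A ≤ d • 1 := by
  obtain ⟨a, ha, h⟩ := hA.2
  have ha0 : algebraMap R K a ≠ 0 := IsFractionRing.to_map_ne_zero_of_mem_nonZeroDivisors ha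
  refine ⟨(algebraMap R K a)⁻¹, inv_ne_zero ha0, fun b hb => ?_⟩
  rw [Submodule.mem_smul_iff_inv_mul_mem (inv_ne_zero ha0), inv_inv, ← Algebra.smul_def]
  obtain ⟨r, hr⟩ := h b hb
  exact Submodule.mem_one.mpr ⟨r, hr⟩

theorem exists_smul_le (hA : IsNonzeroFractional R K A) (hB : IsNonzeroFractional R K B) :
    ∃ d : K, d ≠ 0 ∧ d • B ≤ A := by
  obtain ⟨a, ha, haA⟩ := hA.exists_smul_one_le
  obtain ⟨b, hb, hBb⟩ := hB.exists_le_smul_one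
  refine ⟨a * b⁻¹, mul_ne_zero ha (inv_ne_zero hb), le_trans ?_ haA⟩
  rw [mul_smul]
  refine smul_mono_right a ((smul_mono_right b⁻¹ hBb).trans_eq ?_)
  rw [inv_smul_smul₀ hb]

theorem div (hA : IsNonzeroFractional R K A) (hB : IsNonzeroFractional R K B) :
    IsNonzeroFractional R K (A / B) := by
  obtain ⟨d, hd, hdB⟩ := hA.exists_smul_le hB
  obtain ⟨b, hb, hbB⟩ := hB.exists_smul_one_le
  refine (smul_one hd).of_le (hA.smul (inv_ne_zero hb)) ?_ ?_
  · rwa [Submodule.le_div_iff_mul_le, smul_mul_assoc, one_mul]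
  · rw [← colon_one A, ← colon_smul hb, colon_one]
    exact colon_mono le_rfl hbB

theorem inf (hA : IsNonzeroFractional R K A) (hB : IsNonzeroFractional R K B) :
    IsNonzeroFractional R K (A ⊓ B) := by
  obtain ⟨d, hd, hdB⟩ := hA.exists_smul_le hB
  obtain ⟨p, q, -, rfl⟩ := IsFractionRing.div_surjective (A := R) d
  have hp : algebraMap R K p ≠ 0 := (div_ne_zero_iff.mp hd).1
  have hq0 : algebraMap R K q ≠ 0 := (div_ne_zero_iff.mp hd).2
  have smul_le : ∀ (r : R) (C : Submodule R K), algebraMap R K r • C ≤ C := by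
    rintro r C _ ⟨z, hz, rfl⟩
    have := C.smul_mem r hz
    rwa [Algebra.smul_def] at this
  refine (hB.smul hp).of_le hA (le_inf ?_ (smul_le p B)) inf_le_left
  rw [← mul_div_cancel₀ (algebraMap R K p) hq0, mul_smul]
  exact (smul_mono_right _ hdB).trans (smul_le q A)

end IsNonzeroFractional

variable {A B C D : Submodule R K} {d : K}

theorem len_smul (hd : d ≠ 0) (A B : Submodule R K) : len (d • A) (d • B) = len A B :=
  len_map (f := DistribSMul.toLinearMap R K d) (smul_right_injective K hd) A B

/-- The relative length of two nonzero fractional ideals: `ℓ(A / B)` when `B ≤ A`, and in general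
`ℓ(A / A ∩ B) - ℓ(B / A ∩ B)`, so that it is additive without any containments. -/
noncomputable def relLen (A B : Submodule R K) : ℤ :=
  ((len A (A ⊓ B)).toNat : ℤ) - (len B (A ⊓ B)).toNat

theorem relLen_of_le (h : B ≤ A) : relLen A B = (len A B).toNat := by
  rw [relLen, inf_eq_right.mpr h, len_self, ENat.toNat_zero, Nat.cast_zero, sub_zero]

theorem relLen_nonneg (h : B ≤ A) : 0 ≤ relLen A B :=
  relLen_of_le h ▸ Int.natCast_nonneg _

theorem relLen_self (A : Submodule R K) : relLen A A = 0 := by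
  rw [relLen, inf_idem, sub_self]

theorem relLen_smul_smul (hd : d ≠ 0) (A B : Submodule R K) :
    relLen (d • A) (d • B) = relLen A B := by
  have h : d • A ⊓ d • B = d • (A ⊓ B) := (Submodule.map_inf _ (smul_right_injective K hd)).symm
  rw [relLen, relLen, h, len_smul hd, len_smul hd]

variable [IsFractionRing R K] [IsDomain R] [IsNoetherianRing R] [Ring.KrullDimLE 1 R]

theorem len_one_smul_one_ne_top {a : R} (ha : a ≠ 0) :
    len (1 : Submodule R K) (algebraMap R K a • 1) ≠ ⊤ := by
  have key : Module.length R (R ⧸ Ideal.span {a}) ≠ ⊤ := Module.length_ne_top_iff.mpr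
    (isFiniteLength_quotient_span_singleton R (mem_nonZeroDivisors_of_ne_zero ha))
  rw [← inK_top, ← inK_span_mul, len_inK, Ideal.mul_top]
  refine ne_top_of_le_ne_top key (Module.length_le_of_injective
    (Submodule.mapQ _ _ (⊤ : Ideal R).subtype le_rfl) ?_)
  rw [← LinearMap.ker_eq_bot]
  exact Submodule.ker_liftQ_eq_bot _ _ _ fun x hx => Ideal.Quotient.eq_zero_iff_mem.mp hx

theorem IsNonzeroFractional.len_ne_top (hA : IsNonzeroFractional R K A)
    (hB : IsNonzeroFractional R K B) (h : B ≤ A) : len A B ≠ ⊤ := by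
  obtain ⟨d, hd, hAd⟩ := hA.exists_le_smul_one
  obtain ⟨b, hb, hbB⟩ := hB.exists_smul_one_le
  refine ne_top_of_le_ne_top ?_ (len_mono hbB h hAd)
  obtain ⟨r, hr⟩ : ∃ r : R, algebraMap R K r = d⁻¹ * b := by
    rw [← Submodule.mem_one, ← Submodule.mem_smul_iff_inv_mul_mem hd]
    refine hAd (h (hbB ?_))
    rw [Submodule.smul_one_eq_span]
    exact Submodule.mem_span_singleton_self b
  have hdr : b • (1 : Submodule R K) = d • algebraMap R K r • 1 := by
    rw [smul_smul, hr, mul_inv_cancel_left₀ hd]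
  rw [hdr, len_smul hd]
  refine len_one_smul_one_ne_top fun hr0 => mul_ne_zero (inv_ne_zero hd) hb ?_
  rw [← hr, hr0, map_zero]

theorem len_toNat_add (hA : IsNonzeroFractional R K A) (hC : IsNonzeroFractional R K C)
    (hCB : C ≤ B) (hBA : B ≤ A) :
    (len A C).toNat = (len B C).toNat + (len A B).toNat := by
  have hB := hC.of_le hA hCB hBA
  rw [len_add hCB hBA, ENat.toNat_add (hB.len_ne_top hC hCB) (hA.len_ne_top hB hBA)]

theorem relLen_eq_sub (hA : IsNonzeroFractional R K A) (hB : IsNonzeroFractional R K B)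
    (hD : IsNonzeroFractional R K D) (hDA : D ≤ A) (hDB : D ≤ B) :
    relLen A B = (len A D).toNat - (len B D).toNat := by
  rw [relLen, len_toNat_add hA hD (le_inf hDA hDB) inf_le_left,
    len_toNat_add hB hD (le_inf hDA hDB) inf_le_right]
  push_cast
  ring

theorem relLen_add (hA : IsNonzeroFractional R K A) (hB : IsNonzeroFractional R K B)
    (hC : IsNonzeroFractional R K C) : relLen A B + relLen B C = relLen A C := by
  have hD := (hA.inf hB).inf hC
  rw [relLen_eq_sub hA hB hD (inf_le_left.trans inf_le_left) (inf_le_left.trans inf_le_right),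
    relLen_eq_sub hB hC hD (inf_le_left.trans inf_le_right) inf_le_right,
    relLen_eq_sub hA hC hD (inf_le_left.trans inf_le_left) inf_le_right, sub_add_sub_cancel]

theorem relLen_self_smul_eq (hd : d ≠ 0) (hA : IsNonzeroFractional R K A)
    (hB : IsNonzeroFractional R K B) : relLen A (d • A) = relLen B (d • B) := by
  have h₁ := relLen_add hA (hA.smul hd) (hB.smul hd)
  have h₂ := relLen_add hA hB (hB.smul hd)
  rw [relLen_smul_smul hd] at h₁
  linarith

theorem relLen_self_pow_smul (hd : d ≠ 0) (hA : IsNonzeroFractional R K A) (n : ℕ) :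
    relLen A (d ^ n • A) = n * relLen A (d • A) := by
  induction n with
  | zero => rw [pow_zero, one_smul, relLen_self, Nat.cast_zero, zero_mul]
  | succ n ih =>
    have hdn := hA.smul (pow_ne_zero n hd)
    rw [← relLen_add hA hdn (hA.smul (pow_ne_zero _ hd)), ih, pow_succ, mul_smul,
      relLen_smul_smul (pow_ne_zero n hd), Nat.cast_succ, add_one_mul]

theorem eq_of_relLen_eq_zero (hA : IsNonzeroFractional R K A) (hB : IsNonzeroFractional R K B)
    (h : B ≤ A) (h0 : relLen A B = 0) : A = B := by
  refine le_antisymm (len_eq_zero_iff.mp ?_) h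
  rw [relLen_of_le h, Nat.cast_eq_zero, ENat.toNat_eq_zero] at h0
  exact h0.resolve_right (hA.len_ne_top hB h)

end Fractional

section Duality

variable {R K : Type*} [CommRing R] [Field K] [Algebra R K] {W A B : Submodule R K}

theorem len_colon_le_one_of_covBy [IsLocalRing R]
    (hW : len (W / inK K (IsLocalRing.maximalIdeal R)) W ≤ 1) (h : B ⋖ A) :
    len (W / B) (W / A) ≤ 1 := by
  obtain ⟨y, hyA, hyB⟩ := SetLike.exists_of_lt h.lt
  have hle : B ⊔ Submodule.span R {y} ≤ A :=
    sup_le h.le ((Submodule.span_singleton_le_iff_mem _ _).mpr hyA)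
  have hA : B ⊔ Submodule.span R {y} = A :=
    (h.eq_or_eq le_sup_left hle).resolve_left (Submodule.lt_sup_iff_notMem.mpr hyB).ne'
  refine (len_le_of_mem_iff (LinearMap.mulRight R y) (fun z hz => ?_) fun z hz => ?_).trans hW
  · rw [Submodule.mem_div_iff_forall_mul_mem] at hz ⊢
    rintro _ ⟨a, ha, rfl⟩
    have := hz _ (smul_mem_of_covBy h ha hyA)
    rwa [Algebra.smul_def, mul_left_comm, mul_comm] at this
  · rw [Submodule.mem_div_iff_forall_mul_mem] at hz ⊢
    refine ⟨fun hzy w hw => ?_, fun hzA => hzA y hyA⟩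
    rw [← hA] at hw
    obtain ⟨b, hb, _, hy, rfl⟩ := Submodule.mem_sup.mp hw
    obtain ⟨a, rfl⟩ := Submodule.mem_span_singleton.mp hy
    rw [mul_add, mul_smul_comm]
    exact W.add_mem (hz b hb) (W.smul_mem a hzy)

theorem IsCanonicalIdeal.isNonzeroFractional (hW : IsCanonicalIdeal R K W) :
    IsNonzeroFractional R K W := ⟨hW.1, hW.2.1⟩

theorem IsCanonicalIdeal.colon_colon (hW : IsCanonicalIdeal R K W)
    (hA : IsNonzeroFractional R K A) : W / (W / A) = A := hW.2.2 A hA.1 hA.2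

theorem IsCanonicalIdeal.colon_lt_colon (hW : IsCanonicalIdeal R K W)
    (hA : IsNonzeroFractional R K A) (hB : IsNonzeroFractional R K B) (h : B < A) :
    W / A < W / B := by
  refine (colon_mono le_rfl h.le).lt_of_ne fun hAB => h.ne ?_
  rw [← hW.colon_colon hA, hAB, hW.colon_colon hB]

variable [IsFractionRing R K] [IsDomain R]

theorem IsCanonicalIdeal.colon_covBy_colon (hW : IsCanonicalIdeal R K W)
    (hA : IsNonzeroFractional R K A) (hB : IsNonzeroFractional R K B) (h : B ⋖ A) :
    W / A ⋖ W / B := by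
  refine ⟨hW.colon_lt_colon hA hB h.lt, fun P hAP hPB => ?_⟩
  have hWA := hW.isNonzeroFractional.div hA
  have hWB := hW.isNonzeroFractional.div hB
  have hP := hWA.of_le hWB hAP.le hPB.le
  refine h.2 (c := W / P) ?_ ?_
  · exact hW.colon_colon hB ▸ hW.colon_lt_colon hWB hP hPB
  · exact hW.colon_colon hA ▸ hW.colon_lt_colon hP hWA hAP

variable [IsNoetherianRing R]

theorem IsNonzeroFractional.fg (hA : IsNonzeroFractional R K A) : A.FG :=
  have : IsNoetherian R A := FractionalIdeal.isNoetherian ⟨A, hA.2⟩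
  Module.Finite.iff_fg.mp (Module.IsNoetherian.finite R A)

variable [Ring.KrullDimLE 1 R]

theorem len_colon_le (hW : ∀ A B : Submodule R K, IsNonzeroFractional R K A →
      IsNonzeroFractional R K B → B ⋖ A → len (W / B) (W / A) ≤ 1)
    (hA : IsNonzeroFractional R K A) (hB : IsNonzeroFractional R K B) (h : B ≤ A) :
    len (W / B) (W / A) ≤ len A B := by
  induction hn : (len A B).toNat generalizing A with
  | zero =>
    obtain rfl := h.antisymm (len_eq_zero_iff.mp
      ((ENat.toNat_eq_zero.mp hn).resolve_right (hA.len_ne_top hB h)))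
    simp only [len_self, le_refl]
  | succ n ih =>
    have hne : B ≠ A := by rintro rfl; simp [len_self] at hn
    obtain ⟨C, hBC, hCA⟩ := exists_le_covBy_of_fg hA.fg (h.lt_of_ne hne)
    have hC := hB.of_le hA hBC hCA.le
    have hlen := len_eq_one_of_covBy hCA
    have hCn : (len C B).toNat = n := by
      rw [len_toNat_add hA hB hBC hCA.le, hlen, ENat.toNat_one] at hn
      exact Nat.succ_injective hn
    rw [len_add hBC hCA.le, hlen, len_add (colon_mono le_rfl hCA.le) (colon_mono le_rfl hBC),
      add_comm]
    exact add_le_add (ih hC hBC hCn) (hW A C hA hC hCA)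

theorem IsCanonicalIdeal.len_colon_colon (hW : IsCanonicalIdeal R K W)
    (hA : IsNonzeroFractional R K A) (hB : IsNonzeroFractional R K B) (h : B ≤ A) :
    len (W / B) (W / A) = len A B := by
  have hcov : ∀ A B : Submodule R K, IsNonzeroFractional R K A → IsNonzeroFractional R K B →
      B ⋖ A → len (W / B) (W / A) ≤ 1 := fun A B hA hB hBA =>
    (len_eq_one_of_covBy (hW.colon_covBy_colon hA hB hBA)).le
  refine (len_colon_le hcov hA hB h).antisymm ?_
  have := len_colon_le hcov (hW.isNonzeroFractional.div hB) (hW.isNonzeroFractional.div hA)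
    (colon_mono le_rfl h)
  rwa [hW.colon_colon hA, hW.colon_colon hB] at this

theorem IsCanonicalIdeal.relLen_colon_colon (hW : IsCanonicalIdeal R K W)
    (hA : IsNonzeroFractional R K A) (hB : IsNonzeroFractional R K B) :
    relLen (W / B) (W / A) = relLen A B := by
  have key : ∀ A B : Submodule R K, IsNonzeroFractional R K A → IsNonzeroFractional R K B →
      B ≤ A → relLen (W / B) (W / A) = relLen A B := fun A B hA hB h => by
    rw [relLen_of_le h, relLen_of_le (colon_mono le_rfl h), hW.len_colon_colon hA hB h]
  have hAB := hA.inf hB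
  have hWF := hW.isNonzeroFractional
  have h₁ := key A (A ⊓ B) hA hAB inf_le_left
  have h₂ := key B (A ⊓ B) hB hAB inf_le_right
  have h₃ := relLen_add (hWF.div hAB) (hWF.div hB) (hWF.div hA)
  have h₄ := relLen_add hA hB hAB
  linarith

/-- The colon with `W` shortens lengths, so as soon as it is an involution on one fractional ideal
it is one on all of them. -/
theorem isCanonicalIdeal_of_colon_colon (hWF : IsNonzeroFractional R K W)
    (hW : ∀ A B : Submodule R K, IsNonzeroFractional R K A → IsNonzeroFractional R K B →
      B ⋖ A → len (W / B) (W / A) ≤ 1)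
    (hB : IsNonzeroFractional R K B) (hWB : W / (W / B) = B) : IsCanonicalIdeal R K W := by
  refine ⟨hWF.1, hWF.2, fun J hJ₀ hJ => le_antisymm ?_ (le_colon_colon W J)⟩
  replace hJ : IsNonzeroFractional R K J := ⟨hJ₀, hJ⟩
  obtain ⟨e, he, heB⟩ := hJ.exists_smul_le hB
  have heBF := hB.smul he
  have hrefl : W / (W / e • B) = e • B := by
    rw [colon_smul he, colon_smul (inv_ne_zero he), inv_inv, hWB]
  have hlen : len (W / (W / J)) (e • B) ≤ len J (e • B) := by
    refine le_trans ?_ (len_colon_le hW hJ heBF heB)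
    conv_lhs => rw [← hrefl]
    exact len_colon_le hW (hWF.div heBF) (hWF.div hJ) (colon_mono le_rfl heB)
  rw [len_add heB (le_colon_colon W J)] at hlen
  refine len_eq_zero_iff.mp (nonpos_iff_eq_zero.mp ?_)
  exact (ENat.add_le_add_iff_left (hJ.len_ne_top heBF heB)).mp (hlen.trans_eq (add_zero _).symm)

end Duality

section Overring

variable {R A : Type*} [CommRing R] [CommRing A] [Algebra R A]

theorem one_le_toSubmodule (S : Subalgebra R A) : 1 ≤ Subalgebra.toSubmodule S :=
  Submodule.one_le.mpr S.one_mem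

theorem toSubmodule_mul_self (S : Subalgebra R A) :
    Subalgebra.toSubmodule S * Subalgebra.toSubmodule S = Subalgebra.toSubmodule S :=
  (Subalgebra.isIdempotentElem_toSubmodule S).eq

theorem le_mul_toSubmodule (M : Submodule R A) (S : Subalgebra R A) :
    M ≤ M * Subalgebra.toSubmodule S := by
  simpa only [mul_one] using mul_le_mul' (le_refl M) (one_le_toSubmodule S)

theorem colon_toSubmodule_mul (M : Submodule R A) (S : Subalgebra R A) :
    M / Subalgebra.toSubmodule S * Subalgebra.toSubmodule S = M / Subalgebra.toSubmodule S := by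
  refine le_antisymm ?_ (le_mul_toSubmodule _ S)
  rw [Submodule.le_div_iff_mul_le, mul_assoc, toSubmodule_mul_self]
  exact colon_mul_le _ _

theorem colon_toSubmodule_le (M : Submodule R A) (S : Subalgebra R A) :
    M / Subalgebra.toSubmodule S ≤ M := by
  simpa only [colon_one] using colon_mono (le_refl M) (one_le_toSubmodule S)

end Overring

section Normalization

variable {R K : Type*} [CommRing R] [Field K] [Algebra R K]

theorem mem_smul_normalization_iff_dvd {g y : integralClosure R K} :
    (y : K) ∈ (g : K) • normalization R K ↔ g ∣ y := by
  rw [Submodule.mem_smul_pointwise_iff_exists]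
  constructor
  · rintro ⟨w, hw, hgw⟩
    exact ⟨⟨w, hw⟩, Subtype.ext hgw.symm⟩
  · rintro ⟨w, rfl⟩
    exact ⟨w, w.2, rfl⟩

theorem exists_eq_smul_normalization [IsPrincipalIdealRing (integralClosure R K)]
    {J : Submodule R K} (hJ : J ≠ ⊥) (hle : J ≤ normalization R K)
    (hmul : J * normalization R K ≤ J) :
    ∃ g : integralClosure R K, g ≠ 0 ∧ J = (g : K) • normalization R K := by
  let a : Ideal (integralClosure R K) :=
    { carrier := {y | (y : K) ∈ J}
      zero_mem' := J.zero_mem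
      add_mem' := J.add_mem
      smul_mem' := fun c y hy => by
        have hyc : (y : K) * c ∈ J := hmul (Submodule.mul_mem_mul hy c.2)
        rwa [mul_comm] at hyc }
  obtain ⟨g, hg⟩ := (IsPrincipalIdealRing.principal a).principal
  have hmem (y : integralClosure R K) : (y : K) ∈ J ↔ (y : K) ∈ (g : K) • normalization R K := by
    rw [mem_smul_normalization_iff_dvd, ← Ideal.mem_span_singleton, ← Ideal.submodule_span_eq,
      ← hg]
    rfl
  have heq : J = (g : K) • normalization R K := by
    refine le_antisymm (fun z hz => (hmem ⟨z, hle hz⟩).mp hz) ?_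
    rintro _ ⟨w, hw, rfl⟩
    exact (hmem (g * ⟨w, hw⟩)).mpr ⟨w, hw, rfl⟩
  refine ⟨g, ?_, heq⟩
  rintro rfl
  exact hJ (heq.trans (zero_smul K (normalization R K)))

/-- The natural map from `R` to the residue field of `R̄` is onto, that is, `k ≅ R̄ / t R̄`. -/
def IsResiduallyRational (R K : Type*) [CommRing R] [Field K] [Algebra R K]
    [IsLocalRing (integralClosure R K)] : Prop :=
  Function.Surjective ((IsLocalRing.residue (integralClosure R K)).comp
    (algebraMap R (integralClosure R K)))

theorem IsResiduallyRational.exists_not_isUnit_sub [IsLocalRing (integralClosure R K)]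
    (hres : IsResiduallyRational R K) (y : integralClosure R K) :
    ∃ r : R, ¬ IsUnit (y - algebraMap R (integralClosure R K) r) := by
  obtain ⟨r, hr⟩ := hres (IsLocalRing.residue _ y)
  refine ⟨r, ?_⟩
  rw [← mem_nonunits_iff, ← IsLocalRing.mem_maximalIdeal, ← IsLocalRing.residue_eq_zero_iff,
    map_sub, sub_eq_zero]
  exact hr.symm

variable [IsFractionRing R K]

theorem isUnit_algebraMap_integralClosure_iff {a : R} :
    IsUnit (algebraMap R (integralClosure R K) a) ↔ IsUnit a := by
  have : FaithfulSMul R (integralClosure R K) :=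
    (faithfulSMul_iff_algebraMap_injective R _).mpr fun x y h =>
      IsFractionRing.injective R K (congrArg Subtype.val h)
  exact isUnit_map_iff _ a

variable [Module.Finite R (integralClosure R K)]

theorem isNonzeroFractional_normalization : IsNonzeroFractional R K (normalization R K) :=
  ⟨ne_bot_of_le_ne_bot IsNonzeroFractional.one.1 (one_le_toSubmodule _),
    FractionalIdeal.isFractional_of_fg (Module.Finite.iff_fg.mp ‹_›)⟩

theorem IsNonzeroFractional.of_one_le_of_le_normalization {A : Submodule R K} (h₁ : 1 ≤ A)
    (hA : A ≤ normalization R K) : IsNonzeroFractional R K A :=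
  one.of_le isNonzeroFractional_normalization h₁ hA

variable [IsDomain R]

theorem isNonzeroFractional_conductorIdeal : IsNonzeroFractional R K (conductorIdeal R K) :=
  IsNonzeroFractional.one.div isNonzeroFractional_normalization

variable [IsPrincipalIdealRing (integralClosure R K)]

variable (R K) in
theorem exists_conductorIdeal_eq :
    ∃ g : integralClosure R K, g ≠ 0 ∧ conductorIdeal R K = (g : K) • normalization R K :=
  exists_eq_smul_normalization isNonzeroFractional_conductorIdeal.1
    ((colon_toSubmodule_le _ _).trans (one_le_toSubmodule _)) (colon_toSubmodule_mul _ _).le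

theorem one_div_conductorIdeal : 1 / conductorIdeal R K = normalization R K := by
  obtain ⟨g, hg, h⟩ := exists_conductorIdeal_eq R K
  have hgK : (g : K) ≠ 0 := (integralClosure R K).coe_eq_zero.not.mpr hg
  rw [h, colon_smul hgK, ← conductorIdeal, h, inv_smul_smul₀ hgK]

end Normalization

section TypeSequence

open IsDiscreteValuationRing

variable {R K : Type*} [CommRing R] [Field K] [Algebra R K]

theorem exists_algebraMap_eq_of_mem_conductorIdeal {y : integralClosure R K}
    (h : (y : K) ∈ conductorIdeal R K) : ∃ a : R, algebraMap R (integralClosure R K) a = y := by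
  obtain ⟨a, ha⟩ := Submodule.mem_one.mp (colon_toSubmodule_le _ _ h)
  exact ⟨a, Subtype.ext ha⟩

variable [IsDiscreteValuationRing (integralClosure R K)]

theorem semigroupElt_zero : semigroupElt R K 0 = 0 :=
  Nat.nth_zero_of_zero ⟨1, by rw [val, map_one, addVal_one]; rfl⟩

theorem valIdeal_zero : valIdeal R K 0 = ⊤ := by
  refine eq_top_iff.mpr fun a _ => ?_
  change (semigroupElt R K 0 : ℕ∞) ≤ val R K a
  rw [semigroupElt_zero]
  exact zero_le

variable [IsFractionRing R K] [Module.Finite R (integralClosure R K)] [IsDomain R]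

variable (R K) in
theorem valueSemigroup_infinite : (valueSemigroup R K).Infinite := by
  obtain ⟨g, hg, h⟩ := exists_conductorIdeal_eq R K
  obtain ⟨t, ht⟩ := exists_irreducible (integralClosure R K)
  obtain ⟨c, hc⟩ := ENat.ne_top_iff_exists.mp (addVal_eq_top_iff.not.mpr hg)
  refine Set.infinite_of_not_bddAbove ?_
  rintro ⟨b, hb⟩
  have hmem : c + (b + 1) ∈ valueSemigroup R K := by
    obtain ⟨a, ha⟩ := exists_algebraMap_eq_of_mem_conductorIdeal
      (h ▸ mem_smul_normalization_iff_dvd.mpr (dvd_mul_right g (t ^ (b + 1))))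
    refine ⟨a, ?_⟩
    rw [val, ha, addVal_mul, ht.addVal_pow, ← hc]
    rfl
  have := hb hmem
  lia

theorem mem_valIdeal_succ {i : ℕ} {a : R} :
    a ∈ valIdeal R K (i + 1) ↔ (semigroupElt R K i : ℕ∞) < val R K a := by
  have hlt : semigroupElt R K i < semigroupElt R K (i + 1) :=
    (Nat.nth_lt_nth (valueSemigroup_infinite R K)).mpr i.lt_succ_self
  refine ⟨fun h => lt_of_lt_of_le (by exact_mod_cast hlt) h, fun h => ?_⟩
  refine le_of_not_gt fun (ha : val R K a < semigroupElt R K (i + 1)) => h.not_ge ?_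
  obtain ⟨n, hn⟩ := ENat.ne_top_iff_exists.mp ha.ne_top
  rw [← hn] at ha ⊢
  exact_mod_cast Nat.le_nth_of_lt_nth_succ (Nat.cast_lt.mp ha) ⟨a, hn.symm⟩

theorem valIdeal_succ_le (i : ℕ) : valIdeal R K (i + 1) ≤ valIdeal R K i :=
  fun _ ha => (mem_valIdeal_succ.mp ha).le

variable (R K) in
theorem exists_inK_valIdeal_eq_conductorIdeal :
    ∃ n, inK K (valIdeal R K n) = conductorIdeal R K := by
  classical
  obtain ⟨g, hg, h⟩ := exists_conductorIdeal_eq R K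
  obtain ⟨c, hc⟩ := ENat.ne_top_iff_exists.mp (addVal_eq_top_iff.not.mpr hg)
  have hcS : c ∈ valueSemigroup R K := by
    obtain ⟨a, ha⟩ := exists_algebraMap_eq_of_mem_conductorIdeal
      (h ▸ mem_smul_normalization_iff_dvd.mpr (dvd_refl g))
    exact ⟨a, by rw [val, ha, hc]⟩
  refine ⟨Nat.count (· ∈ valueSemigroup R K) c, ?_⟩
  have hsc : semigroupElt R K (Nat.count (· ∈ valueSemigroup R K) c) = c :=
    Nat.nth_count (p := (· ∈ valueSemigroup R K)) hcS
  have hiff (a : R) : a ∈ valIdeal R K (Nat.count (· ∈ valueSemigroup R K) c) ↔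
      algebraMap R K a ∈ conductorIdeal R K := by
    change (semigroupElt R K _ : ℕ∞) ≤ val R K a ↔ _
    rw [hsc, hc, val, addVal_le_iff_dvd, h, ← mem_smul_normalization_iff_dvd]
    rfl
  ext z
  constructor
  · intro hz
    obtain ⟨a, ha, rfl⟩ := (IsLocalization.mem_coeSubmodule K _).mp hz
    exact (hiff a).mp ha
  · intro hz
    obtain ⟨a, rfl⟩ := Submodule.mem_one.mp (colon_toSubmodule_le _ _ hz)
    exact mem_inK.mpr ((hiff a).mpr hz)

variable [IsLocalRing R]

theorem valIdeal_succ_covBy (hres : IsResiduallyRational R K) (i : ℕ) :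
    valIdeal R K (i + 1) ⋖ valIdeal R K i := by
  obtain ⟨b, hb⟩ : ∃ b : R, val R K b = semigroupElt R K i :=
    Nat.nth_mem_of_infinite (valueSemigroup_infinite R K) i
  have hpos (y : integralClosure R K) (hy : ¬ IsUnit y) :
      (semigroupElt R K i : ℕ∞) < addVal _ (y * algebraMap R _ b) := by
    have hy₁ : 1 ≤ addVal _ y := Order.one_le_iff_ne_zero.mpr fun h => hy (addVal_eq_zero_iff.mp h)
    rw [addVal_mul]
    calc (semigroupElt R K i : ℕ∞) < 1 + semigroupElt R K i := by
          rw [add_comm]; exact_mod_cast Nat.lt_succ_self _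
      _ ≤ _ := add_le_add hy₁ hb.ge
  refine covBy_of_le_sup_span (z := b) hb.ge
    (fun h => (mem_valIdeal_succ.mp h).ne' hb) (valIdeal_succ_le i) (fun a ha => ?_) fun a ha => ?_
  · rw [mem_valIdeal_succ, val, smul_eq_mul, map_mul]
    exact hpos _ fun h => ha (isUnit_algebraMap_integralClosure_iff.mp h)
  · obtain ⟨y, hy⟩ := addVal_le_iff_dvd.mp (hb.le.trans ha)
    obtain ⟨r, hr⟩ := hres.exists_not_isUnit_sub y
    refine Submodule.mem_sup.mpr ⟨a - r * b, ?_, r * b,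
      Ideal.mem_span_singleton.mpr (dvd_mul_left b r), sub_add_cancel _ _⟩
    have hval : algebraMap R (integralClosure R K) (a - r * b) =
        (y - algebraMap R _ r) * algebraMap R _ b := by
      rw [map_sub, map_mul, hy]; ring
    rw [mem_valIdeal_succ, val, hval]
    exact hpos _ hr

theorem valIdeal_one (hres : IsResiduallyRational R K) :
    valIdeal R K 1 = IsLocalRing.maximalIdeal R := by
  have h := valIdeal_succ_covBy hres 0
  rw [valIdeal_zero, covBy_top_iff] at h
  exact IsLocalRing.eq_maximalIdeal ⟨h⟩

theorem len_one_valIdeal (hres : IsResiduallyRational R K) (i : ℕ) :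
    len (1 : Submodule R K) (inK K (valIdeal R K i)) = i := by
  rw [← inK_top, len_inK]
  induction i with
  | zero => rw [valIdeal_zero, len_self, Nat.cast_zero]
  | succ i ih =>
    rw [len_add (valIdeal_succ_le i) le_top, ih,
      len_eq_one_of_covBy (valIdeal_succ_covBy hres i), add_comm, Nat.cast_succ]

theorem cmType_eq (hres : IsResiduallyRational R K) :
    cmType R K = len (1 / inK K (IsLocalRing.maximalIdeal R)) 1 := by
  rw [cmType, typeSeq, valIdeal_one hres, Nat.sub_self, valIdeal_zero, inK_top, colon_one]

theorem IsAlmostGorenstein.len_one_div_valIdeal (hAG : IsAlmostGorenstein R K)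
    (hres : IsResiduallyRational R K) {k : ℕ}
    (hk : (k + 1 : ℕ) ≤ len (1 : Submodule R K) (conductorIdeal R K)) :
    len (1 / inK K (valIdeal R K (k + 1))) 1 = cmType R K + k := by
  induction k with
  | zero => rw [valIdeal_one hres, cmType_eq hres, Nat.cast_zero, add_zero]
  | succ k ih =>
    have htype := hAG (k + 1 + 1) (by lia) hk
    rw [typeSeq, Nat.add_sub_cancel] at htype
    rw [len_add (Submodule.one_le_one_div.mpr (inK_le_one _))
        (colon_mono le_rfl (inK_mono (valIdeal_succ_le (k + 1)))),
      ih (le_trans (Nat.cast_le.mpr (Nat.le_succ _)) hk), htype, add_assoc, Nat.cast_succ]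

theorem IsAlmostGorenstein.len_normalization (hAG : IsAlmostGorenstein R K)
    (hres : IsResiduallyRational R K) (hne : conductorIdeal R K ≠ 1) :
    len (normalization R K) 1 + 1 = cmType R K + len 1 (conductorIdeal R K) := by
  obtain ⟨n, hn⟩ := exists_inK_valIdeal_eq_conductorIdeal R K
  have hlen : len 1 (conductorIdeal R K) = n := by rw [← hn, len_one_valIdeal hres]
  obtain ⟨m, rfl⟩ : ∃ m, n = m + 1 := by
    refine Nat.exists_eq_succ_of_ne_zero ?_
    rintro rfl
    rw [valIdeal_zero, inK_top] at hn
    exact hne hn.symm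
  have h := hAG.len_one_div_valIdeal hres hlen.ge
  rw [hn, one_div_conductorIdeal] at h
  rw [h, hlen, add_assoc, Nat.cast_succ]

end TypeSequence

section Socle

variable {R M : Type*} [CommRing R] [AddCommGroup M] [Module R M] {N W : Submodule R M} {p z : M}

theorem exists_le_maximal_notMem (hp : p ∉ N) :
    ∃ W, N ≤ W ∧ Maximal (fun V : Submodule R M => p ∉ V) W := by
  refine zorn_le_nonempty₀ {V : Submodule R M | p ∉ V} (fun c hc hchain V hV => ?_) N hp
  refine ⟨sSup c, fun hpc => ?_, fun U hU => le_sSup hU⟩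
  obtain ⟨U, hU, hpU⟩ := (Submodule.mem_sSup_of_directed ⟨V, hV⟩ hchain.directedOn).mp hpc
  exact hc hU hpU

theorem mem_sup_span_of_maximal_notMem [IsLocalRing R]
    (hW : Maximal (fun V : Submodule R M => p ∉ V) W)
    (hz : ∀ a ∈ IsLocalRing.maximalIdeal R, a • z ∈ W) : z ∈ W ⊔ Submodule.span R {p} := by
  by_cases hzW : z ∈ W
  · exact Submodule.mem_sup_left hzW
  have hp : p ∈ W ⊔ Submodule.span R {z} := by
    by_contra hp
    exact hzW (hW.le_of_ge hp le_sup_left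
      (Submodule.mem_sup_right (Submodule.mem_span_singleton_self z)))
  obtain ⟨w, hw, _, hrz, hwz⟩ := Submodule.mem_sup.mp hp
  obtain ⟨r, rfl⟩ := Submodule.mem_span_singleton.mp hrz
  have hr : IsUnit r := by
    by_contra hr
    exact hW.prop (hwz ▸ W.add_mem hw (hz r hr))
  rw [← Submodule.smul_mem_iff_of_isUnit _ hr, ← add_sub_cancel_left w (r • z), hwz]
  exact Submodule.sub_mem _ (Submodule.mem_sup_right (Submodule.mem_span_singleton_self p))
    (Submodule.mem_sup_left hw)

end Socle

section Existence

variable {R K : Type*} [CommRing R] [Field K] [Algebra R K]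

theorem len_colon_maximalIdeal_le_one [IsLocalRing R] {W : Submodule R K}
    {p : K} (hW : Maximal (fun V : Submodule R K => p ∉ V) W)
    (hp : ∀ a ∈ IsLocalRing.maximalIdeal R, a • p ∈ W) :
    len (W / inK K (IsLocalRing.maximalIdeal R)) W ≤ 1 := by
  have hmem {z : K} : z ∈ W / inK K (IsLocalRing.maximalIdeal R) ↔
      ∀ a ∈ IsLocalRing.maximalIdeal R, a • z ∈ W := by
    simp only [Submodule.mem_div_iff_forall_mul_mem, IsLocalization.mem_coeSubmodule,
      forall_exists_index, and_imp, forall_apply_eq_imp_iff₂, Algebra.smul_def, mul_comm]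
  exact (len_eq_one_of_covBy (covBy_of_le_sup_span (hmem.mpr hp) hW.prop
    (fun w hw => hmem.mpr fun a _ => W.smul_mem a hw) hp
    fun z hz => mem_sup_span_of_maximal_notMem hW (hmem.mp hz))).le

theorem dvd_iff_not_isUnit [IsDiscreteValuationRing (integralClosure R K)]
    {t y : integralClosure R K} (ht : Irreducible t) : t ∣ y ↔ ¬ IsUnit y := by
  rw [← Ideal.mem_span_singleton, ← ht.maximalIdeal_eq, IsLocalRing.mem_maximalIdeal,
    mem_nonunits_iff]

variable [IsDiscreteValuationRing (integralClosure R K)] {t g : integralClosure R K}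
  {W : Submodule R K}

theorem IsResiduallyRational.normalization_le (hres : IsResiduallyRational R K)
    (ht : Irreducible t) : normalization R K ≤ 1 ⊔ (t : K) • normalization R K := by
  intro y hy
  obtain ⟨r, hr⟩ := hres.exists_not_isUnit_sub ⟨y, hy⟩
  exact Submodule.mem_sup.mpr ⟨algebraMap R K r, Submodule.algebraMap_mem r, _,
    mem_smul_normalization_iff_dvd.mpr ((dvd_iff_not_isUnit ht).mpr hr), add_sub_cancel _ _⟩

theorem div_notMem_one (hres : IsResiduallyRational R K) (ht : Irreducible t) (hg : g ≠ 0)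
    (hγ : conductorIdeal R K = (g : K) • normalization R K) :
    (g / t : K) ∉ (1 : Submodule R K) := by
  intro h
  have ht₀ : (t : K) ≠ 0 := (integralClosure R K).coe_eq_zero.not.mpr ht.ne_zero
  have hp : (g / t : K) ≠ 0 :=
    div_ne_zero ((integralClosure R K).coe_eq_zero.not.mpr hg) ht₀
  have hgt : (g / t : K) • (t : K) • normalization R K = conductorIdeal R K := by
    rw [smul_smul, div_mul_cancel₀ _ ht₀, hγ]
  have hmem : (g / t : K) ∈ conductorIdeal R K := by
    have hle : (g / t : K) • normalization R K ≤ 1 := by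
      refine (smul_mono_right _ (hres.normalization_le ht)).trans ?_
      rw [Submodule.smul_sup', hgt, Submodule.smul_one_eq_span]
      exact sup_le (by rwa [Submodule.span_singleton_le_iff_mem]) (colon_toSubmodule_le _ _)
    exact Submodule.mem_div_iff_forall_mul_mem.mpr fun y hy =>
      hle (Submodule.smul_mem_pointwise_smul y _ _ hy)
  rw [← hgt, Submodule.mem_smul_iff_inv_mul_mem hp, inv_mul_cancel₀ hp] at hmem
  exact ht.not_isUnit (isUnit_of_dvd_one
    ((mem_smul_normalization_iff_dvd (y := 1)).mp hmem))

variable [IsFractionRing R K]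

theorem smul_div_mem_conductorIdeal [IsLocalRing R] (ht : Irreducible t)
    (hγ : conductorIdeal R K = (g : K) • normalization R K) {a : R}
    (ha : a ∈ IsLocalRing.maximalIdeal R) : a • (g / t : K) ∈ conductorIdeal R K := by
  have ht₀ : (t : K) ≠ 0 := (integralClosure R K).coe_eq_zero.not.mpr ht.ne_zero
  obtain ⟨y, hy⟩ := (dvd_iff_not_isUnit ht).mpr
    fun h => ha (isUnit_algebraMap_integralClosure_iff (K := K).mp h)
  have haK : algebraMap R K a = t * y := congrArg Subtype.val hy
  have hgy : a • (g / t : K) = (g : K) • (y : K) := by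
    rw [Algebra.smul_def, haK, smul_eq_mul]
    field_simp
  rw [hgy, hγ]
  exact Submodule.smul_mem_pointwise_smul _ _ _ y.2

variable [IsDomain R]

theorem inv_mem_smul_normalization (ht : Irreducible t) {z : K} (hz : z ∉ normalization R K) :
    z⁻¹ ∈ (t : K) • normalization R K := by
  have : IsFractionRing (integralClosure R K) K :=
    integralClosure.isFractionRing_of_finite_extension K K
  obtain ⟨y, hy⟩ | ⟨y, hy⟩ := ValuationRing.isInteger_or_isInteger (integralClosure R K) z
  · exact absurd (hy ▸ y.2) hz
  rw [← hy]
  refine mem_smul_normalization_iff_dvd.mpr ((dvd_iff_not_isUnit ht).mpr ?_)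
  rintro ⟨u, rfl⟩
  rw [← inv_inv z, ← hy, ← map_units_inv] at hz
  exact hz (Subtype.prop _)

theorem le_normalization_of_div_notMem (ht : Irreducible t)
    (hγ : conductorIdeal R K = (g : K) • normalization R K) (hW : (g / t : K) ∉ W) :
    W ≤ normalization R K := by
  refine fun w hw => by_contra fun hwN => hW ?_
  have hw₀ : w ≠ 0 := by rintro rfl; exact hwN (Submodule.zero_mem _)
  have ht₀ : (t : K) ≠ 0 := (integralClosure R K).coe_eq_zero.not.mpr ht.ne_zero
  obtain ⟨y, hy, hty⟩ := inv_mem_smul_normalization ht hwN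
  obtain ⟨r, hr⟩ := Submodule.mem_one.mp (colon_toSubmodule_le _ _
    (hγ ▸ Submodule.smul_mem_pointwise_smul y (g : K) _ hy : (g : K) * y ∈ conductorIdeal R K))
  have hrw : (g / t : K) = r • w := by
    have htyw : (t : K) * y * w = 1 :=
      (congrArg (· * w) hty).trans (inv_mul_cancel₀ hw₀)
    rw [Algebra.smul_def, hr, div_eq_iff ht₀]
    linear_combination -(g : K) * htyw
  exact hrw ▸ W.smul_mem r hw

theorem colon_normalization_of_div_notMem (ht : Irreducible t)
    (hγ : conductorIdeal R K = (g : K) • normalization R K) (h₁ : 1 ≤ W) (hg : g ≠ 0)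
    (hW : (g / t : K) ∉ W) : W / normalization R K = conductorIdeal R K := by
  refine le_antisymm (fun z hz => ?_) (colon_mono h₁ le_rfl)
  have hg₀ : (g : K) ≠ 0 := (integralClosure R K).coe_eq_zero.not.mpr hg
  have ht₀ : (t : K) ≠ 0 := (integralClosure R K).coe_eq_zero.not.mpr ht.ne_zero
  rw [hγ, Submodule.mem_smul_iff_inv_mul_mem hg₀]
  refine by_contra fun hzg => hW ?_
  have hz₀ : z ≠ 0 := by rintro rfl; exact hzg (by rw [mul_zero]; exact Submodule.zero_mem _)
  obtain ⟨y, hy, hty⟩ := inv_mem_smul_normalization ht hzg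
  have hzy : (g / t : K) = z * y := by
    change (t : K) * y = _ at hty
    rw [mul_inv, inv_inv] at hty
    rw [div_eq_iff ht₀, mul_assoc, mul_comm y, hty, mul_left_comm, mul_inv_cancel₀ hz₀, mul_one]
  exact hzy ▸ Submodule.mem_div_iff_forall_mul_mem.mp hz y hy

variable [Module.Finite R (integralClosure R K)] [IsLocalRing R] [IsNoetherianRing R]
  [Ring.KrullDimLE 1 R]

theorem exists_isNormalizedCanonicalIdeal (hres : IsResiduallyRational R K) :
    ∃ W : Submodule R K, IsNormalizedCanonicalIdeal R K W := by
  obtain ⟨g, hg, hγ⟩ := exists_conductorIdeal_eq R K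
  obtain ⟨t, ht⟩ := IsDiscreteValuationRing.exists_irreducible (integralClosure R K)
  obtain ⟨W, h₁, hW⟩ := exists_le_maximal_notMem (div_notMem_one hres ht hg hγ)
  have hWN : W ≤ normalization R K := le_normalization_of_div_notMem ht hγ hW.prop
  have hWγ : W / normalization R K = conductorIdeal R K :=
    colon_normalization_of_div_notMem ht hγ h₁ hg hW.prop
  have hrefl : W / (W / normalization R K) = normalization R K := by
    have hgK : (g : K) ≠ 0 := (integralClosure R K).coe_eq_zero.not.mpr hg
    rw [hWγ, hγ, colon_smul hgK, hWγ, hγ, inv_smul_smul₀ hgK]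
  have hsocle := len_colon_maximalIdeal_le_one hW fun a ha =>
    h₁ (colon_toSubmodule_le _ _ (smul_div_mem_conductorIdeal ht hγ ha))
  exact ⟨W, isCanonicalIdeal_of_colon_colon (.of_one_le_of_le_normalization h₁ hWN)
    (fun A B _ _ => len_colon_le_one_of_covBy hsocle) isNonzeroFractional_normalization hrefl,
    h₁, hWN⟩

end Existence

section Canonical

variable {R K : Type*} [CommRing R] [Field K] [Algebra R K] [IsFractionRing R K]
  {ω : Submodule R K}

theorem IsCanonicalIdeal.colon_self (hω : IsCanonicalIdeal R K ω) : ω / ω = 1 := by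
  simpa only [colon_one] using hω.colon_colon .one

theorem IsCanonicalIdeal.one_colon (hω : IsCanonicalIdeal R K ω) (J : Submodule R K) :
    1 / J = ω / (ω * J) := by
  rw [colon_mul, hω.colon_self]

theorem IsNormalizedCanonicalIdeal.colon_normalization (hω : IsNormalizedCanonicalIdeal R K ω) :
    ω / normalization R K = conductorIdeal R K := by
  have h : ω * normalization R K = normalization R K :=
    le_antisymm ((mul_le_mul' hω.2.2 le_rfl).trans (toSubmodule_mul_self _).le)
      (le_mul_of_one_le_left' hω.2.1)
  rw [conductorIdeal, hω.1.one_colon, h]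

end Canonical

theorem starDual_toSubmodule_le_maximalIdeal {R K : Type*} [CommRing R] [IsLocalRing R]
    [Field K] [Algebra R K] [IsFractionRing R K] {A : Subalgebra R K}
    (hA : Subalgebra.toSubmodule A ≠ 1) :
    starDual K (Subalgebra.toSubmodule A) ≤ inK K (IsLocalRing.maximalIdeal R) := by
  intro z hz
  obtain ⟨a, rfl⟩ := Submodule.mem_one.mp (colon_toSubmodule_le _ _ hz)
  refine mem_inK.mpr fun ha => hA (le_antisymm ?_ (one_le_toSubmodule A))
  rw [← Submodule.one_mem_div, ← Submodule.smul_mem_iff_of_isUnit _ ha, Algebra.smul_def, mul_one]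
  exact hz

theorem maximalIdeal_ne_bot (R K : Type*) [CommRing R] [IsLocalRing R] [Field K]
    [Algebra R K] [IsFractionRing R K] [IsDiscreteValuationRing (integralClosure R K)] :
    IsLocalRing.maximalIdeal R ≠ ⊥ := by
  rw [Ne, ← IsLocalRing.isField_iff_maximalIdeal_eq, Algebra.IsIntegral.isField_iff_isField
    (S := integralClosure R K) fun x y h =>
      IsFractionRing.injective R K (congrArg Subtype.val h)]
  exact IsDiscreteValuationRing.not_isField _

section AlmostGorenstein

variable {R K : Type*} [CommRing R] [IsDomain R] [Field K] [Algebra R K] [IsFractionRing R K]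

theorem conductorIdeal_ne_one [Module.Finite R (integralClosure R K)]
    [IsPrincipalIdealRing (integralClosure R K)] {A : Subalgebra R K}
    (hA : Subalgebra.toSubmodule A ≠ 1) (hAN : A ≤ integralClosure R K) :
    conductorIdeal R K ≠ 1 := by
  intro h
  have hN : 1 = normalization R K := by
    simpa only [h, colon_one] using one_div_conductorIdeal (R := R) (K := K)
  exact hA (le_antisymm (hN.ge.trans' hAN) (one_le_toSubmodule A))

variable [IsLocalRing R] [IsDiscreteValuationRing (integralClosure R K)] [IsNoetherianRing R]
  [Ring.KrullDimLE 1 R] [Module.Finite R (integralClosure R K)]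
  {ω : Submodule R K} {A : Subalgebra R K}

theorem cmType_ne_top (hres : IsResiduallyRational R K) : cmType R K ≠ ⊤ := by
  rw [cmType_eq hres]
  exact (IsNonzeroFractional.one.div (.inK (maximalIdeal_ne_bot R K))).len_ne_top .one
    (Submodule.one_le_one_div.mpr (inK_le_one _))

theorem IsNormalizedCanonicalIdeal.relLen_one (hω : IsNormalizedCanonicalIdeal R K ω)
    (hAG : IsAlmostGorenstein R K) (hres : IsResiduallyRational R K)
    (hγ : conductorIdeal R K ≠ 1) : relLen ω 1 = (cmType R K).toNat - 1 := by
  have hN : IsNonzeroFractional R K (normalization R K) := isNonzeroFractional_normalization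
  have hNω : relLen (normalization R K) ω = relLen 1 (conductorIdeal R K) := by
    rw [← hω.1.relLen_colon_colon hN hω.1.isNonzeroFractional, hω.1.colon_self,
      hω.colon_normalization]
  have hN₁ : relLen (normalization R K) 1 + 1 =
      (cmType R K).toNat + relLen 1 (conductorIdeal R K) := by
    have hγ₁ := colon_toSubmodule_le (1 : Submodule R K) (integralClosure R K)
    rw [relLen_of_le (one_le_toSubmodule _), conductorIdeal, relLen_of_le hγ₁]
    have h := congrArg ENat.toNat (hAG.len_normalization hres hγ)
    rw [ENat.toNat_add (hN.len_ne_top .one (one_le_toSubmodule _)) ENat.one_ne_top,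
      ENat.toNat_add (cmType_ne_top hres)
        (IsNonzeroFractional.one.len_ne_top isNonzeroFractional_conductorIdeal hγ₁)] at h
    exact_mod_cast h
  have hadd := relLen_add hN hω.1.isNonzeroFractional .one
  linarith

theorem IsNormalizedCanonicalIdeal.mul_maximalIdeal (hω : IsNormalizedCanonicalIdeal R K ω)
    (hAG : IsAlmostGorenstein R K) (hres : IsResiduallyRational R K)
    (hγ : conductorIdeal R K ≠ 1) :
    ω * inK K (IsLocalRing.maximalIdeal R) = inK K (IsLocalRing.maximalIdeal R) := by
  have hm : IsNonzeroFractional R K (inK K (IsLocalRing.maximalIdeal R)) :=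
    .inK (maximalIdeal_ne_bot R K)
  have hωm := hω.1.isNonzeroFractional.mul hm
  have hm₁ : relLen 1 (inK K (IsLocalRing.maximalIdeal R)) = 1 := by
    rw [relLen_of_le (inK_le_one _), ← valIdeal_one hres, len_one_valIdeal hres]
    rfl
  have hr : relLen ω (ω * inK K (IsLocalRing.maximalIdeal R)) = (cmType R K).toNat := by
    rw [← hω.1.relLen_colon_colon hω.1.isNonzeroFractional hωm, ← hω.1.one_colon,
      hω.1.colon_self, relLen_of_le (Submodule.one_le_one_div.mpr (inK_le_one _)), cmType_eq hres]
  refine eq_of_relLen_eq_zero hωm hm (le_mul_of_one_le_left' hω.2.1) ?_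
  have h₁ := relLen_add hω.1.isNonzeroFractional hωm hm
  have h₂ := relLen_add hω.1.isNonzeroFractional .one hm
  have h₃ := hω.relLen_one hAG hres hγ
  linarith

theorem IsNormalizedCanonicalIdeal.mul_starDual (hω : IsNormalizedCanonicalIdeal R K ω)
    (hAG : IsAlmostGorenstein R K) (hres : IsResiduallyRational R K)
    (hA : Subalgebra.toSubmodule A ≠ 1) (hAN : A ≤ integralClosure R K) :
    ω * starDual K (Subalgebra.toSubmodule A) = starDual K (Subalgebra.toSubmodule A) := by
  refine le_antisymm ?_ (le_mul_of_one_le_left' hω.2.1)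
  rw [Submodule.le_div_iff_mul_le, mul_assoc, colon_toSubmodule_mul]
  calc ω * starDual K (Subalgebra.toSubmodule A)
      ≤ ω * inK K (IsLocalRing.maximalIdeal R) :=
        mul_le_mul' le_rfl (starDual_toSubmodule_le_maximalIdeal hA)
    _ = inK K (IsLocalRing.maximalIdeal R) :=
        hω.mul_maximalIdeal hAG hres (conductorIdeal_ne_one hA hAN)
    _ ≤ 1 := inK_le_one _

theorem IsNormalizedCanonicalIdeal.relLen_starDual_starDual
    (hω : IsNormalizedCanonicalIdeal R K ω) (hAG : IsAlmostGorenstein R K)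
    (hres : IsResiduallyRational R K) (hA : Subalgebra.toSubmodule A ≠ 1)
    (hAN : A ≤ integralClosure R K) :
    relLen (starDual K (starDual K (Subalgebra.toSubmodule A))) 1 =
      relLen 1 (starDual K (Subalgebra.toSubmodule A)) + (cmType R K).toNat - 1 := by
  have hdual : IsNonzeroFractional R K (starDual K (Subalgebra.toSubmodule A)) :=
    IsNonzeroFractional.one.div (.of_one_le_of_le_normalization (one_le_toSubmodule A) hAN)
  have h₁ : relLen (starDual K (starDual K (Subalgebra.toSubmodule A))) 1 =
      relLen ω (starDual K (Subalgebra.toSubmodule A)) := by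
    rw [← hω.1.relLen_colon_colon hω.1.isNonzeroFractional hdual, hω.1.colon_self, starDual,
      hω.1.one_colon (starDual K _), hω.mul_starDual hAG hres hA hAN]
  have h₂ := hω.relLen_one hAG hres (conductorIdeal_ne_one hA hAN)
  have h₃ := relLen_add hω.1.isNonzeroFractional .one hdual
  linarith

end AlmostGorenstein

section RestrictScalars

variable {R K : Type*} [CommRing R] [Field K] [Algebra R K] (A : Subalgebra R K)

theorem restrictScalars_one : (1 : Submodule A K).restrictScalars R = Subalgebra.toSubmodule A := by
  ext z
  rw [Submodule.restrictScalars_mem, Submodule.mem_one]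
  exact ⟨fun ⟨y, hy⟩ => hy ▸ y.2, fun hz => ⟨⟨z, hz⟩, rfl⟩⟩

theorem restrictScalars_colon (P Q : Submodule A K) :
    (P / Q).restrictScalars R = P.restrictScalars R / Q.restrictScalars R := by
  ext z
  rw [Submodule.restrictScalars_mem, Submodule.mem_div_iff_forall_mul_mem,
    Submodule.mem_div_iff_forall_mul_mem]
  rfl

theorem exists_restrictScalars_eq {J : Submodule R K} (hJ : Subalgebra.toSubmodule A * J ≤ J) :
    ∃ J' : Submodule A K, J'.restrictScalars R = J :=
  ⟨{ J with smul_mem' := fun a _ hz => hJ (Submodule.mul_mem_mul a.2 hz) }, rfl⟩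

theorem toSubmodule_mul_restrictScalars_le (J : Submodule A K) :
    Subalgebra.toSubmodule A * J.restrictScalars R ≤ J.restrictScalars R :=
  Submodule.mul_le.mpr fun a ha _ hz => J.smul_mem ⟨a, ha⟩ hz

variable {A} [IsFractionRing R K]

theorem isNonzeroFractional_restrictScalars_iff
    (hA : IsNonzeroFractional R K (Subalgebra.toSubmodule A)) {J : Submodule A K} :
    IsNonzeroFractional R K (J.restrictScalars R) ↔ J ≠ ⊥ ∧ IsFractional A⁰ J := by
  have : Nontrivial R := (algebraMap R K).domain_nontrivial
  rw [IsNonzeroFractional, Ne, Submodule.restrictScalars_eq_bot_iff]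
  refine and_congr_right fun _ => ⟨fun ⟨r, hr, h⟩ => ?_, fun ⟨a, ha, h⟩ => ?_⟩
  · refine ⟨algebraMap R A r, mem_nonZeroDivisors_of_ne_zero fun h0 => ?_, fun b hb => ?_⟩
    · exact IsFractionRing.to_map_ne_zero_of_mem_nonZeroDivisors hr (congrArg Subtype.val h0)
    · obtain ⟨y, hy⟩ := h b hb
      exact ⟨algebraMap R A y, hy.trans (algebraMap_smul A r b).symm⟩
  · have ha₀ : (a : K) ≠ 0 := A.coe_eq_zero.not.mpr (nonZeroDivisors.ne_zero ha)
    have hJA : J.restrictScalars R ≤ (a : K)⁻¹ • Subalgebra.toSubmodule A := by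
      intro z hz
      obtain ⟨y, hy⟩ := h z hz
      rw [Submodule.mem_smul_iff_inv_mul_mem (inv_ne_zero ha₀), inv_inv]
      exact (show (y : K) = a * z from hy) ▸ y.2
    exact (hA.smul (inv_ne_zero ha₀)).2.imp
      fun _ h => ⟨h.1, fun b hb => h.2 b (hJA hb)⟩

theorem isGorenstein_iff (hA : IsNonzeroFractional R K (Subalgebra.toSubmodule A)) :
    IsGorenstein A K ↔ ∀ J : Submodule R K, IsNonzeroFractional R K J →
      Subalgebra.toSubmodule A * J ≤ J →
      Subalgebra.toSubmodule A / (Subalgebra.toSubmodule A / J) = J := by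
  have hbidual (J : Submodule A K) : 1 / (1 / J) = J ↔
      Subalgebra.toSubmodule A / (Subalgebra.toSubmodule A / J.restrictScalars R) =
        J.restrictScalars R := by
    rw [← restrictScalars_one, ← restrictScalars_colon, ← restrictScalars_colon,
      Submodule.restrictScalars_inj]
  constructor
  · rintro ⟨-, -, h⟩ J hJ hAJ
    obtain ⟨J, rfl⟩ := exists_restrictScalars_eq A hAJ
    obtain ⟨hJ₀, hJfrac⟩ := (isNonzeroFractional_restrictScalars_iff hA).mp hJ
    exact (hbidual J).mp (h J hJ₀ hJfrac)
  · intro h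
    obtain ⟨h₁₀, h₁⟩ := (isNonzeroFractional_restrictScalars_iff hA (J := 1)).mp
      (by rwa [restrictScalars_one])
    exact ⟨h₁₀, h₁, fun J hJ₀ hJ => (hbidual J).mpr
      (h _ ((isNonzeroFractional_restrictScalars_iff hA).mpr ⟨hJ₀, hJ⟩)
        (toSubmodule_mul_restrictScalars_le A J))⟩

end RestrictScalars

section GorensteinOverring

variable {R K : Type*} [CommRing R] [Field K] [Algebra R K]

theorem mul_eq_of_toSubmodule_mul_le {A : Subalgebra R K} {J : Submodule R K}
    (h : Subalgebra.toSubmodule A * J ≤ J) : Subalgebra.toSubmodule A * J = J :=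
  le_antisymm h (le_mul_of_one_le_left' (one_le_toSubmodule A))

theorem toSubmodule_colon_self (A : Subalgebra R K) :
    Subalgebra.toSubmodule A / Subalgebra.toSubmodule A = Subalgebra.toSubmodule A :=
  le_antisymm (colon_toSubmodule_le _ A)
    (Submodule.le_div_iff_mul_le.mpr (toSubmodule_mul_self A).le)

theorem toSubmodule_mul_colon (A : Subalgebra R K) (J : Submodule R K) :
    Subalgebra.toSubmodule A * (Subalgebra.toSubmodule A / J) = Subalgebra.toSubmodule A / J := by
  refine mul_eq_of_toSubmodule_mul_le ?_
  rw [Submodule.le_div_iff_mul_le, mul_assoc]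
  exact (mul_le_mul' le_rfl (colon_mul_le _ J)).trans (toSubmodule_mul_self A).le

theorem inv_mem_of_isIntegral_inv {A : Subalgebra R K} {z : K} (hz : z ∈ A)
    (h : IsIntegral R z⁻¹) : z⁻¹ ∈ A := by
  obtain rfl | hz₀ := eq_or_ne z 0
  · rwa [inv_zero] at h ⊢
  have : FaithfulSMul A (integralClosure A K) :=
    (faithfulSMul_iff_algebraMap_injective A _).mpr fun x y hxy =>
      Subtype.ext (congrArg (Subtype.val (p := (· ∈ integralClosure A K))) hxy)
  have hunit : IsUnit (algebraMap A (integralClosure A K) ⟨z, hz⟩) :=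
    .of_mul_eq_one ⟨z⁻¹, h.tower_top⟩ (Subtype.ext (mul_inv_cancel₀ hz₀))
  obtain ⟨w, hw⟩ := ((isUnit_map_iff _ _).mp hunit).exists_right_inv
  rw [← eq_inv_of_mul_eq_one_right (congrArg Subtype.val hw)]
  exact w.2

variable [IsFractionRing R K] {ω : Submodule R K} {A : Subalgebra R K}

theorem IsCanonicalIdeal.isGorenstein_of_colon_eq (hω : IsCanonicalIdeal R K ω)
    (hA : IsNonzeroFractional R K (Subalgebra.toSubmodule A)) {d : K} (hd : d ≠ 0)
    (h : ω / Subalgebra.toSubmodule A = d • Subalgebra.toSubmodule A) : IsGorenstein A K := by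
  refine (isGorenstein_iff hA).mpr fun J hJ hAJ => ?_
  have hcolon {P : Submodule R K} (hP : Subalgebra.toSubmodule A * P = P) :
      Subalgebra.toSubmodule A / P = d⁻¹ • (ω / P) := by
    rw [← inv_smul_smul₀ hd (Subalgebra.toSubmodule A), ← h, smul_colon (inv_ne_zero hd),
      ← colon_mul, hP]
  rw [hcolon (toSubmodule_mul_colon A J), hcolon (mul_eq_of_toSubmodule_mul_le hAJ),
    colon_smul (inv_ne_zero hd), inv_inv, inv_smul_smul₀ hd, hω.colon_colon hJ]

variable [IsDomain R]

-- If `A` is Gorenstein, both `C = ω : A` and `D = A : C` have endomorphism ring `A`, so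
-- `A : CD = D : D = A` and `CD = A` by reflexivity: `C` is invertible.
theorem IsCanonicalIdeal.mul_colon_eq_of_isGorenstein (hω : IsCanonicalIdeal R K ω)
    (hA : IsNonzeroFractional R K (Subalgebra.toSubmodule A)) (hG : IsGorenstein A K) :
    ω / Subalgebra.toSubmodule A *
      (Subalgebra.toSubmodule A / (ω / Subalgebra.toSubmodule A)) = Subalgebra.toSubmodule A := by
  rw [isGorenstein_iff hA] at hG
  set C := ω / Subalgebra.toSubmodule A with hC
  set D := Subalgebra.toSubmodule A / C with hD
  have hCfrac : IsNonzeroFractional R K C := hω.isNonzeroFractional.div hA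
  have hAC : Subalgebra.toSubmodule A * C = C :=
    mul_eq_of_toSubmodule_mul_le (by rw [mul_comm, hC, colon_toSubmodule_mul])
  have hCC : C / C = Subalgebra.toSubmodule A := by
    nth_rw 1 [hC]
    rw [← colon_mul, hAC, hω.colon_colon hA]
  have hDD : D / D = Subalgebra.toSubmodule A := by
    nth_rw 1 [hD]
    rw [← colon_mul, mul_comm, colon_mul, hD, hG C hCfrac hAC.le, hCC]
  have hCD : Subalgebra.toSubmodule A / (C * D) = Subalgebra.toSubmodule A := by
    rw [colon_mul, ← hD, hDD]
  rw [← hG (C * D) (hCfrac.mul (hA.div hCfrac)) (by rw [← mul_assoc, hAC]), hCD,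
    toSubmodule_colon_self]

variable [IsDiscreteValuationRing (integralClosure R K)]

-- Since `R̄` is a discrete valuation ring, `A` is local, so its invertible ideals are principal.
theorem exists_eq_smul_toSubmodule_of_mul_eq {C D : Submodule R K}
    (hC : C * Subalgebra.toSubmodule A = C) (h : C * D = Subalgebra.toSubmodule A) :
    ∃ c : K, c ≠ 0 ∧ C = c • Subalgebra.toSubmodule A := by
  obtain ⟨t, ht⟩ := IsDiscreteValuationRing.exists_irreducible (integralClosure R K)
  obtain ⟨c, hc, d, hd, hcd⟩ : ∃ c ∈ C, ∃ d ∈ D, c * d ∉ (t : K) • normalization R K := by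
    by_contra! hall
    have h₁ : ((1 : integralClosure R K) : K) ∈ (t : K) • normalization R K :=
      Submodule.mul_le.mpr hall (h ▸ A.one_mem)
    exact ht.not_isUnit (isUnit_of_dvd_one (mem_smul_normalization_iff_dvd.mp h₁))
  have hcd₀ : c * d ≠ 0 := fun h₀ => hcd (h₀ ▸ Submodule.zero_mem _)
  have hcdA : c * d ∈ A := h.le (Submodule.mul_mem_mul hc hd)
  have hinv : (c * d)⁻¹ ∈ A := inv_mem_of_isIntegral_inv hcdA <| by
    by_contra hnot
    exact hcd (inv_inv (c * d) ▸ inv_mem_smul_normalization ht hnot)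
  have hc₀ := left_ne_zero_of_mul hcd₀
  refine ⟨c, hc₀, le_antisymm (fun z hz => ?_) ?_⟩
  · rw [Submodule.mem_smul_iff_inv_mul_mem hc₀]
    have hzd : z * d ∈ A := h.le (Submodule.mul_mem_mul hz hd)
    have heq : c⁻¹ * z = z * d * (c * d)⁻¹ := by
      field_simp [hc₀, right_ne_zero_of_mul hcd₀]
    exact heq ▸ A.mul_mem hzd hinv
  · rintro _ ⟨a, ha, rfl⟩
    exact hC.le (Submodule.mul_mem_mul hc ha)

theorem IsCanonicalIdeal.exists_colon_eq_smul (hω : IsCanonicalIdeal R K ω)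
    (hA : IsNonzeroFractional R K (Subalgebra.toSubmodule A)) (hG : IsGorenstein A K) :
    ∃ c : K, c ≠ 0 ∧ ω / Subalgebra.toSubmodule A = c • Subalgebra.toSubmodule A :=
  exists_eq_smul_toSubmodule_of_mul_eq (colon_toSubmodule_mul ω A)
    (hω.mul_colon_eq_of_isGorenstein hA hG)

end GorensteinOverring

section AlmostGorensteinOverring

variable {R K : Type*} [CommRing R] [IsDomain R] [Field K] [Algebra R K] [IsFractionRing R K]
  [IsNoetherianRing R] [Ring.KrullDimLE 1 R] [Module.Finite R (integralClosure R K)]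
  {ω : Submodule R K} {A : Subalgebra R K} {d : K}

theorem IsNormalizedCanonicalIdeal.relLen_conductorIdeal (hω : IsNormalizedCanonicalIdeal R K ω)
    (hAN : A ≤ integralClosure R K) (hd : d ≠ 0)
    (h : ω / Subalgebra.toSubmodule A = d • Subalgebra.toSubmodule A) :
    relLen (normalization R K) (conductorIdeal R K) =
      relLen (normalization R K) (Subalgebra.toSubmodule A / normalization R K) +
        relLen (Subalgebra.toSubmodule A) (d • Subalgebra.toSubmodule A) := by
  have hA : IsNonzeroFractional R K (Subalgebra.toSubmodule A) :=
    .of_one_le_of_le_normalization (one_le_toSubmodule A) hAN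
  have hN : IsNonzeroFractional R K (normalization R K) := isNonzeroFractional_normalization
  have hmul : Subalgebra.toSubmodule A * normalization R K = normalization R K :=
    mul_eq_of_toSubmodule_mul_le ((mul_le_mul' (Subalgebra.toSubmodule.monotone hAN) le_rfl).trans
      (toSubmodule_mul_self _).le)
  have hγ : conductorIdeal R K = d • (Subalgebra.toSubmodule A / normalization R K) := by
    rw [← hω.colon_normalization, ← smul_colon hd, ← h, ← colon_mul, hmul]
  rw [hγ, relLen_self_smul_eq hd hA (hA.div hN)]
  exact (relLen_add hN (hA.div hN) ((hA.div hN).smul hd)).symm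

variable [IsDiscreteValuationRing (integralClosure R K)]

theorem IsNormalizedCanonicalIdeal.colon_eq_smul_iff (hω : IsNormalizedCanonicalIdeal R K ω)
    (hAN : A ≤ integralClosure R K) (hd : d ≠ 0)
    (hle : d • Subalgebra.toSubmodule A ≤ ω / Subalgebra.toSubmodule A) :
    ω / Subalgebra.toSubmodule A = d • Subalgebra.toSubmodule A ↔
      IsGorenstein A K ∧ relLen (normalization R K) (conductorIdeal R K) -
        relLen (normalization R K) (Subalgebra.toSubmodule A / normalization R K) =
          relLen (Subalgebra.toSubmodule A) (d • Subalgebra.toSubmodule A) := by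
  have hA : IsNonzeroFractional R K (Subalgebra.toSubmodule A) :=
    .of_one_le_of_le_normalization (one_le_toSubmodule A) hAN
  constructor
  · intro h
    exact ⟨hω.1.isGorenstein_of_colon_eq hA hd h,
      sub_eq_iff_eq_add'.mpr (hω.relLen_conductorIdeal hAN hd h)⟩
  · rintro ⟨hG, hlen⟩
    obtain ⟨c, hc, h⟩ := hω.1.exists_colon_eq_smul hA hG
    rw [hω.relLen_conductorIdeal hAN hc h, add_sub_cancel_left] at hlen
    have hadd := relLen_add hA (hA.smul hc) (hA.smul hd)
    exact eq_of_relLen_eq_zero (hω.1.isNonzeroFractional.div hA) (hA.smul hd) hle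
      (by rw [h]; linarith)

variable [IsLocalRing R]

theorem IsNormalizedCanonicalIdeal.two_mul_relLen (hω : IsNormalizedCanonicalIdeal R K ω)
    (hAG : IsAlmostGorenstein R K) (hres : IsResiduallyRational R K)
    (hA : Subalgebra.toSubmodule A ≠ 1) (hAN : A ≤ integralClosure R K) (hd : d ≠ 0) :
    2 * relLen (Subalgebra.toSubmodule A) 1 =
      relLen (Subalgebra.toSubmodule A) (d • Subalgebra.toSubmodule A) + (cmType R K).toNat - 1 -
        relLen (starDual K (Subalgebra.toSubmodule A)) (d • Subalgebra.toSubmodule A) -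
        relLen (starDual K (starDual K (Subalgebra.toSubmodule A))) (Subalgebra.toSubmodule A) := by
  have hAfrac : IsNonzeroFractional R K (Subalgebra.toSubmodule A) :=
    .of_one_le_of_le_normalization (one_le_toSubmodule A) hAN
  have hdual := IsNonzeroFractional.one.div hAfrac
  have h₁ := relLen_add (IsNonzeroFractional.one.div hdual) hAfrac .one
  have h₂ := relLen_add .one hdual (hAfrac.smul hd)
  have h₃ := relLen_add hAfrac .one (hAfrac.smul hd)
  have h₄ := hω.relLen_starDual_starDual hAG hres hA hAN
  linarith

theorem IsNormalizedCanonicalIdeal.mul_toSubmodule_of_starDual_eq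
    (hω : IsNormalizedCanonicalIdeal R K ω) (hAG : IsAlmostGorenstein R K)
    (hres : IsResiduallyRational R K) (hA : Subalgebra.toSubmodule A ≠ 1)
    (hAN : A ≤ integralClosure R K) (hd : d ≠ 0)
    (h : starDual K (Subalgebra.toSubmodule A) = d • Subalgebra.toSubmodule A) :
    ω * Subalgebra.toSubmodule A = Subalgebra.toSubmodule A := by
  have hmul := hω.mul_starDual hAG hres hA hAN
  rw [h, mul_smul_comm] at hmul
  exact MulAction.injective₀ hd hmul

theorem IsNormalizedCanonicalIdeal.two_mul_relLen_tfae (hω : IsNormalizedCanonicalIdeal R K ω)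
    (hAG : IsAlmostGorenstein R K) (hres : IsResiduallyRational R K)
    (hA : Subalgebra.toSubmodule A ≠ 1) (hAN : A ≤ integralClosure R K) (hd : d ≠ 0)
    (hd₁ : d • Subalgebra.toSubmodule A ≤ 1) :
    List.TFAE [
      2 * relLen (Subalgebra.toSubmodule A) 1 =
        relLen (Subalgebra.toSubmodule A) (d • Subalgebra.toSubmodule A) + (cmType R K).toNat - 1,
      IsGorenstein A K ∧ relLen (normalization R K) (conductorIdeal R K) -
        relLen (normalization R K) (Subalgebra.toSubmodule A / normalization R K) =
          relLen (Subalgebra.toSubmodule A) (d • Subalgebra.toSubmodule A),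
      starDual K (Subalgebra.toSubmodule A) = d • Subalgebra.toSubmodule A,
      ω / Subalgebra.toSubmodule A = d • Subalgebra.toSubmodule A] := by
  have hAfrac : IsNonzeroFractional R K (Subalgebra.toSubmodule A) :=
    .of_one_le_of_le_normalization (one_le_toSubmodule A) hAN
  have hdual := IsNonzeroFractional.one.div hAfrac
  have hle : d • Subalgebra.toSubmodule A ≤ starDual K (Subalgebra.toSubmodule A) := by
    rwa [Submodule.le_div_iff_mul_le, smul_mul_assoc, toSubmodule_mul_self]
  have hle' := colon_mono hω.2.1 (le_refl (Subalgebra.toSubmodule A))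
  have hformula := hω.two_mul_relLen hAG hres hA hAN hd
  tfae_have 1 → 3 := fun h => by
    have h₁ := relLen_nonneg hle
    have h₂ := relLen_nonneg (le_colon_colon 1 (Subalgebra.toSubmodule A))
    exact eq_of_relLen_eq_zero hdual (hAfrac.smul hd) hle (by linarith)
  tfae_have 3 → 1 := fun h => by
    have hbidual : starDual K (starDual K (Subalgebra.toSubmodule A)) =
        Subalgebra.toSubmodule A := by
      rw [h, starDual, colon_smul hd, ← starDual, h, inv_smul_smul₀ hd]
    rwa [hbidual, h, relLen_self, relLen_self, sub_zero, sub_zero] at hformula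
  tfae_have 3 → 4 := fun h => by
    rw [← h, starDual, hω.1.one_colon, hω.mul_toSubmodule_of_starDual_eq hAG hres hA hAN hd h]
  tfae_have 4 → 3 := fun h => le_antisymm (hle'.trans h.le) hle
  tfae_have 4 ↔ 2 := hω.colon_eq_smul_iff hAN hd (hle.trans hle')
  tfae_finish

end AlmostGorensteinOverring

section Hilbert

variable {R : Type*} [CommRing R] {I : Ideal R} {ν : ℕ} {e : ℤ}

theorem hPolynomial_eq_of_isHPolynomial {p : ℤ[X]} (hp : IsHPolynomial I p) :
    hPolynomial I = p := by
  have hex : ∃ p : ℤ[X], IsHPolynomial I p := ⟨p, hp⟩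
  rw [hPolynomial, dif_pos hex]
  exact Polynomial.coe_injective ℤ (hex.choose_spec.trans hp.symm)

theorem isHPolynomial_of_eventually_const (he : ∀ n ≥ ν, ((hilbertFn I n).toNat : ℤ) = e) :
    IsHPolynomial I (Polynomial.C e + (1 - Polynomial.X) * ∑ j ∈ Finset.range ν,
      Polynomial.C (((hilbertFn I j).toNat : ℤ) - e) * Polynomial.X ^ j) := by
  set q := ∑ j ∈ Finset.range ν,
    Polynomial.C (((hilbertFn I j).toNat : ℤ) - e) * Polynomial.X ^ j with hq
  have hseries : hilbertSeries I = PowerSeries.C e * PowerSeries.mk 1 + (q : ℤ⟦X⟧) := by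
    ext n
    rw [hilbertSeries, PowerSeries.coeff_mk, map_add, PowerSeries.coeff_C_mul,
      PowerSeries.coeff_mk, Polynomial.coeff_coe, hq, Polynomial.finsetSum_coeff]
    simp only [Polynomial.coeff_C_mul_X_pow, Pi.one_apply, mul_one, Finset.sum_ite_eq,
      Finset.mem_range]
    split_ifs with h
    · exact (add_sub_cancel _ _).symm
    · rw [add_zero, he n (not_lt.mp h)]
  rw [IsHPolynomial, hseries, mul_add, mul_left_comm,
    mul_comm (1 - PowerSeries.X) (PowerSeries.mk 1), PowerSeries.mk_one_mul_one_sub_eq_one, mul_one]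
  push_cast
  rfl

theorem idealMult_eq_of_eventually_const (he : ∀ n ≥ ν, ((hilbertFn I n).toNat : ℤ) = e) :
    idealMult I = e := by
  rw [idealMult, hPolynomial_eq_of_isHPolynomial (isHPolynomial_of_eventually_const he)]
  simp

theorem genus_eq_of_eventually_const (he : ∀ n ≥ ν, ((hilbertFn I n).toNat : ℤ) = e) :
    genus I = ν * e - ∑ j ∈ Finset.range ν, ((hilbertFn I j).toNat : ℤ) := by
  rw [genus, hPolynomial_eq_of_isHPolynomial (isHPolynomial_of_eventually_const he)]
  simp [Polynomial.eval_finsetSum]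

end Hilbert

section Blowup

variable {R K : Type*} [CommRing R] [Field K] [Algebra R K] {I : Ideal R} {x : R} {n : ℕ}

theorem IsMinimalReduction.pow_succ_eq (h : IsMinimalReduction I x)
    (hn : reductionExponent I x ≤ n) : I ^ (n + 1) = Ideal.span {x} * I ^ n :=
  Nat.sInf_mem h.2 n hn

theorem IsMinimalReduction.inK_pow_add (h : IsMinimalReduction I x)
    (hn : reductionExponent I x ≤ n) (k : ℕ) :
    inK K (I ^ (n + k)) = algebraMap R K x ^ k • inK K (I ^ n) := by
  induction k with
  | zero => rw [pow_zero, one_smul, add_zero]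
  | succ k ih =>
    rw [← add_assoc, h.pow_succ_eq (hn.trans (Nat.le_add_right n k)), inK_span_mul, ih, smul_smul,
      pow_succ']

theorem IsMinimalReduction.blowupMod_eq_colon (h : IsMinimalReduction I x)
    (hx : algebraMap R K x ≠ 0) (hn : reductionExponent I x ≤ n) :
    blowupMod K I = inK K (I ^ n) / inK K (I ^ n) := by
  ext z
  refine ⟨fun ⟨m, hm⟩ => ?_, fun hz => ⟨n, inK_pow (K := K) I n ▸ hz⟩⟩
  have hz : z ∈ inK K I ^ (n + m) / inK K I ^ (n + m) :=
    colon_self_mono K (inK K I) (Nat.le_add_left m n) hm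
  have hxm := pow_ne_zero m hx
  rwa [← inK_pow, h.inK_pow_add hn, smul_colon hxm, colon_smul hxm, smul_inv_smul₀ hxm] at hz

theorem IsMinimalReduction.inK_pow_eq (h : IsMinimalReduction I x) (hx : algebraMap R K x ≠ 0)
    (hn : reductionExponent I x ≤ n) :
    inK K (I ^ n) = algebraMap R K x ^ n • blowupMod K I := by
  have hxn := pow_ne_zero n hx
  have hmem : algebraMap R K x ^ n • (1 : Submodule R K) ≤ inK K (I ^ n) := by
    rw [Submodule.smul_one_eq_span, Submodule.span_singleton_le_iff_mem, ← map_pow]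
    exact ⟨x ^ n, Ideal.pow_mem_pow h.1 n, rfl⟩
  rw [h.blowupMod_eq_colon hx hn, ← inv_smul_eq_iff₀ hxn]
  refine le_antisymm ?_ ?_
  · rw [Submodule.le_div_iff_mul_le, smul_mul_assoc, ← inK_mul, ← pow_add, h.inK_pow_add hn,
      inv_smul_smul₀ hxn]
  · refine (colon_mono le_rfl hmem).trans_eq ?_
    rw [colon_smul hxn, colon_one]

variable [IsDomain R] [IsFractionRing R K]

theorem IsMinimalReduction.algebraMap_ne_zero (h : IsMinimalReduction I x) (hI : I ≠ ⊥) :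
    algebraMap R K x ≠ 0 := by
  rw [map_ne_zero_iff _ (IsFractionRing.injective R K)]
  rintro rfl
  obtain ⟨m, hm⟩ := h.2
  refine pow_ne_zero (m + 1) hI ?_
  rw [hm m le_rfl, Ideal.span_singleton_eq_bot.mpr rfl, Ideal.bot_mul, Ideal.zero_eq_bot]

theorem IsMinimalReduction.isNonzeroFractional_blowupMod (h : IsMinimalReduction I x)
    (hI : I ≠ ⊥) : IsNonzeroFractional R K (blowupMod K I) := by
  have hx := pow_ne_zero (reductionExponent I x) (h.algebraMap_ne_zero (K := K) hI)
  rw [← inv_smul_smul₀ hx (blowupMod K I), ← h.inK_pow_eq (h.algebraMap_ne_zero hI) le_rfl]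
  exact .smul (inv_ne_zero hx) (.inK (pow_ne_zero _ hI))

theorem IsMinimalReduction.blowup_le_integralClosure [IsNoetherianRing R]
    (h : IsMinimalReduction I x) (hI : I ≠ ⊥) : blowup K I ≤ integralClosure R K :=
  fun z hz => .of_mem_of_fg _ (h.isNonzeroFractional_blowupMod hI).fg z hz

theorem IsMinimalReduction.blowupMod_ne_one (h : IsMinimalReduction I x) (hI : I ≠ ⊥)
    (hIprinc : ¬ Submodule.IsPrincipal I) : blowupMod K I ≠ 1 := by
  intro h₁
  have hx := h.algebraMap_ne_zero (K := K) hI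
  have hpow := h.inK_pow_eq hx (Nat.le_succ (reductionExponent I x))
  rw [Nat.succ_eq_add_one, pow_succ, inK_mul, h.inK_pow_eq hx le_rfl, h₁, smul_mul_assoc, one_mul,
    pow_succ, mul_smul] at hpow
  have hIx : inK K I = inK K (Ideal.span {x}) := by
    rw [MulAction.injective₀ (pow_ne_zero _ hx) hpow, ← inK_top, ← inK_span_mul, Ideal.mul_top]
  exact hIprinc ⟨x, IsFractionRing.coeSubmodule_injective R K hIx⟩

theorem IsMinimalReduction.conditionsA {ω : Submodule R K} (h : IsMinimalReduction I x)
    (hI : I ≠ ⊥) (hω : IsNormalizedCanonicalIdeal R K ω)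
    (hωΛ : ω * blowupMod K I = blowupMod K I) :
    ConditionsA K I (reductionExponent I x) ω := by
  have a5 : ∀ n ≥ reductionExponent I x, ω * inK K (I ^ n) = inK K (I ^ n) := fun n hn => by
    rw [h.inK_pow_eq (h.algebraMap_ne_zero hI) hn, mul_smul_comm, hωΛ]
  exact {
    a1 := (le_mul_toSubmodule ω _).trans hωΛ.le
    a2 := hωΛ
    a3 := by rw [hω.1.one_colon, hωΛ]
    a4 := fun n hn => by rw [mul_comm, a5 n hn, inf_eq_left.mpr (inK_le_one _)]
    a5 := a5
    a6 := ⟨_, Nat.succ_pos _, a5 _ (Nat.le_succ _)⟩ }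

end Blowup

section ExistsReduction

theorem exists_pow_eq_of_le_toSubmodule {R A : Type*} [CommRing R] [CommRing A] [Algebra R A]
    {S : Subalgebra R A} [IsNoetherian R S] {E : Submodule R A} (h₁ : 1 ≤ E)
    (hES : E ≤ Subalgebra.toSubmodule S) : ∃ m, ∀ n ≥ m, E ^ n = E ^ m := by
  have hle (n : ℕ) : E ^ n ≤ Subalgebra.toSubmodule S := by
    induction n with
    | zero => rw [pow_zero]; exact one_le_toSubmodule S
    | succ n ih => rw [pow_succ, ← toSubmodule_mul_self]; exact mul_le_mul' ih hES
  obtain ⟨m, hm⟩ := monotone_stabilizes_iff_noetherian.mpr ‹IsNoetherian R S›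
    ⟨fun n => (E ^ n).submoduleOf (Subalgebra.toSubmodule S),
      fun _ _ hab => Submodule.comap_mono (pow_le_pow_right₀ h₁ hab)⟩
  refine ⟨m, fun n hn => ?_⟩
  have h := congrArg (Submodule.map (Subalgebra.toSubmodule S).subtype) (hm n hn)
  simpa only [OrderHom.coe_mk, Submodule.submoduleOf, Submodule.map_comap_subtype,
    inf_eq_right.mpr (hle _)] using h.symm

variable {R : Type*} (K : Type*) [CommRing R] [Field K] [Algebra R K] [IsFractionRing R K]
  [IsDiscreteValuationRing (integralClosure R K)] {I : Ideal R}

theorem exists_inK_le_smul_normalization (hI : I ≠ ⊥) :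
    ∃ x ∈ I, algebraMap R K x ≠ 0 ∧ inK K I ≤ algebraMap R K x • normalization R K := by
  obtain ⟨x, hxI, hmin⟩ := (InvImage.wf (val R K) wellFounded_lt).has_min (I : Set R)
    ⟨0, I.zero_mem⟩
  have hle : inK K I ≤ algebraMap R K x • normalization R K := by
    rintro _ ⟨y, hy, rfl⟩
    exact mem_smul_normalization_iff_dvd.mpr
      (IsDiscreteValuationRing.addVal_le_iff_dvd.mp (not_lt.mp (hmin y hy)))
  refine ⟨x, hxI, fun hx => (IsNonzeroFractional.inK (K := K) hI).1 ?_, hle⟩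
  rw [hx, zero_smul] at hle
  exact le_bot_iff.mp hle

theorem exists_isMinimalReduction [IsNoetherianRing R]
    [Module.Finite R (integralClosure R K)] (hI : I ≠ ⊥) : ∃ x, IsMinimalReduction I x := by
  obtain ⟨x, hxI, hx, hle⟩ := exists_inK_le_smul_normalization K hI
  obtain ⟨E, hE⟩ : ∃ E, E = (algebraMap R K x)⁻¹ • inK K I := ⟨_, rfl⟩
  have h₁ : 1 ≤ E := hE ▸ Submodule.one_le.mpr ⟨_, mem_inK.mpr hxI, inv_mul_cancel₀ hx⟩
  have hEN : E ≤ normalization R K := by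
    rw [hE]
    exact (smul_mono_right _ hle).trans_eq (inv_smul_smul₀ hx _)
  have hpow (n : ℕ) : inK K (I ^ n) = algebraMap R K x ^ n • E ^ n := by
    rw [hE, inK_pow, ← smul_pow, smul_inv_smul₀ hx]
  obtain ⟨m, hm⟩ := exists_pow_eq_of_le_toSubmodule h₁ hEN
  refine ⟨x, hxI, m, fun n hn => IsFractionRing.coeSubmodule_injective R K ?_⟩
  change inK K _ = inK K _
  rw [inK_span_mul, hpow, hpow, hm n hn, hm _ (hn.trans n.le_succ), smul_smul, pow_succ']

end ExistsReduction

section Invariants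

variable {R : Type*} (K : Type*) [CommRing R] [Field K] [Algebra R K] [IsFractionRing R K]

theorem hilbertFn_toNat (I : Ideal R) (n : ℕ) :
    ((hilbertFn I n).toNat : ℤ) = relLen (inK K (I ^ n)) (inK K (I ^ (n + 1))) := by
  rw [hilbertFn, relLen_of_le (inK_mono (Ideal.pow_le_pow_right n.le_succ)), len_inK]

variable {K} [IsDomain R] {I : Ideal R} {x : R}

theorem IsMinimalReduction.hilbertFn_eq (h : IsMinimalReduction I x) (hI : I ≠ ⊥) {n : ℕ}
    (hn : reductionExponent I x ≤ n) :
    ((hilbertFn I n).toNat : ℤ) = relLen (blowupMod K I) (algebraMap R K x • blowupMod K I) := by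
  have hx := h.algebraMap_ne_zero (K := K) hI
  rw [hilbertFn_toNat K, h.inK_pow_eq hx hn, h.inK_pow_eq hx (hn.trans n.le_succ), pow_succ,
    mul_smul, relLen_smul_smul (pow_ne_zero n hx)]

theorem IsMinimalReduction.isHPolynomial_hPolynomial (h : IsMinimalReduction I x) (hI : I ≠ ⊥) :
    IsHPolynomial I (hPolynomial I) := by
  have hp := isHPolynomial_of_eventually_const (fun _ => h.hilbertFn_eq (K := FractionRing R) hI)
  rwa [hPolynomial_eq_of_isHPolynomial hp]

variable [IsNoetherianRing R] [Ring.KrullDimLE 1 R]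

theorem hilbertFn_ne_top (hI : I ≠ ⊥) (n : ℕ) : hilbertFn I n ≠ ⊤ := by
  rw [hilbertFn, ← len_inK (K := FractionRing R)]
  exact (IsNonzeroFractional.inK (pow_ne_zero n hI)).len_ne_top (.inK (pow_ne_zero (n + 1) hI))
    (inK_mono (Ideal.pow_le_pow_right n.le_succ))

variable (K) in
theorem sum_hilbertFn (hI : I ≠ ⊥) (n : ℕ) :
    ∑ j ∈ Finset.range n, ((hilbertFn I j).toNat : ℤ) = relLen 1 (inK K (I ^ n)) := by
  induction n with
  | zero => rw [Finset.sum_range_zero, pow_zero, Ideal.one_eq_top, inK_top, relLen_self]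
  | succ n ih =>
    rw [Finset.sum_range_succ, ih, hilbertFn_toNat K,
      relLen_add .one (.inK (pow_ne_zero n hI)) (.inK (pow_ne_zero (n + 1) hI))]

theorem IsMinimalReduction.idealMult_mul (h : IsMinimalReduction I x) (hI : I ≠ ⊥) :
    idealMult I * reductionExponent I x =
      relLen (blowupMod K I) (inK K (I ^ reductionExponent I x)) := by
  have hx := h.algebraMap_ne_zero (K := K) hI
  rw [idealMult_eq_of_eventually_const (fun _ => h.hilbertFn_eq (K := K) hI),
    h.inK_pow_eq hx le_rfl, relLen_self_pow_smul hx (h.isNonzeroFractional_blowupMod hI), mul_comm]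

theorem IsMinimalReduction.genus_eq (h : IsMinimalReduction I x) (hI : I ≠ ⊥) :
    genus I = relLen (blowupMod K I) 1 := by
  have he := fun (n : ℕ) => h.hilbertFn_eq (K := K) (n := n) hI
  rw [genus_eq_of_eventually_const he, sum_hilbertFn K hI, mul_comm,
    ← idealMult_eq_of_eventually_const he, h.idealMult_mul (K := K) hI, sub_eq_iff_eq_add]
  exact (relLen_add (h.isNonzeroFractional_blowupMod hI) .one (.inK (pow_ne_zero _ hI))).symm

end Invariants

theorem krullDimLE_one_of_isIntegral (R S : Type*) [CommRing R] [CommRing S] [IsDomain S]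
    [Algebra R S] [FaithfulSMul R S] [Algebra.IsIntegral R S] [Ring.KrullDimLE 1 S] :
    Ring.KrullDimLE 1 R := by
  refine .mk₁' fun P hP hprime => ?_
  obtain ⟨Q, -, hQ, rfl⟩ := Ideal.exists_ideal_over_prime_of_isIntegral P (⊥ : Ideal S)
    (by simp [← RingHom.ker_eq_comap_bot,
      (RingHom.injective_iff_ker_eq_bot _).mp (FaithfulSMul.algebraMap_injective R S)])
  have hQbot : Q ≠ ⊥ := by
    rintro rfl
    exact hP ((RingHom.injective_iff_ker_eq_bot _).mp (FaithfulSMul.algebraMap_injective R S))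
  have := hQ.isMaximal_of_ne_bot hQbot
  exact Ideal.isMaximal_comap_of_isIntegral_of_isMaximal Q

section AlmostGorensteinBlowup

variable {R K : Type*} [CommRing R] [IsDomain R] [Field K] [Algebra R K] [IsFractionRing R K]
  {I : Ideal R} {x : R}

theorem IsMinimalReduction.inK_pow_le_starDual (h : IsMinimalReduction I x) (hI : I ≠ ⊥) :
    inK K (I ^ reductionExponent I x) ≤ starDual K (blowupMod K I) := by
  have hle := inK_le_one (K := K) (I ^ reductionExponent I x)
  rw [h.inK_pow_eq (h.algebraMap_ne_zero hI) le_rfl] at hle ⊢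
  rwa [Submodule.le_div_iff_mul_le, smul_mul_assoc, toSubmodule_mul_self]

variable [IsNoetherianRing R] [Ring.KrullDimLE 1 R] [Module.Finite R (integralClosure R K)]

theorem IsNonzeroFractional.len_normalization_colon_ne_top {J : Submodule R K}
    (hJ : IsNonzeroFractional R K J) (hJN : J ≤ normalization R K) :
    len (normalization R K) (J / normalization R K) ≠ ⊤ :=
  isNonzeroFractional_normalization.len_ne_top (hJ.div isNonzeroFractional_normalization)
    ((colon_toSubmodule_le _ _).trans hJN)

variable [IsLocalRing R] [IsDiscreteValuationRing (integralClosure R K)] {ω : Submodule R K}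

theorem IsMinimalReduction.two_mul_genus (h : IsMinimalReduction I x) (hI : I ≠ ⊥)
    (hIprinc : ¬ Submodule.IsPrincipal I) (hω : IsNormalizedCanonicalIdeal R K ω)
    (hAG : IsAlmostGorenstein R K) (hres : IsResiduallyRational R K) :
    2 * genus I = idealMult I * reductionExponent I x + (cmType R K).toNat - 1
      - (len (starDual K (blowupMod K I)) (inK K (I ^ reductionExponent I x))).toNat
      - (len (starDual K (starDual K (blowupMod K I))) (blowupMod K I)).toNat := by
  have hx := h.algebraMap_ne_zero (K := K) hI
  rw [h.genus_eq (K := K) hI, h.idealMult_mul (K := K) hI,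
    ← relLen_of_le (h.inK_pow_le_starDual hI), ← relLen_of_le (le_colon_colon _ _),
    h.inK_pow_eq hx le_rfl]
  exact hω.two_mul_relLen hAG hres (h.blowupMod_ne_one hI hIprinc)
    (h.blowup_le_integralClosure hI) (pow_ne_zero _ hx)

theorem IsMinimalReduction.two_mul_genus_tfae (h : IsMinimalReduction I x) (hI : I ≠ ⊥)
    (hIprinc : ¬ Submodule.IsPrincipal I) (hω : IsNormalizedCanonicalIdeal R K ω)
    (hAG : IsAlmostGorenstein R K) (hres : IsResiduallyRational R K) :
    List.TFAE [
      2 * genus I = idealMult I * reductionExponent I x + (cmType R K).toNat - 1,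
      IsGorenstein (blowup K I) K ∧ ((condLen R K).toNat : ℤ) - (condLenBlowup K I).toNat =
        idealMult I * reductionExponent I x,
      starDual K (blowupMod K I) = inK K (I ^ reductionExponent I x),
      ω / blowupMod K I = inK K (I ^ reductionExponent I x)] := by
  have hx := h.algebraMap_ne_zero (K := K) hI
  have hN := h.blowup_le_integralClosure (K := K) hI
  have hpow := h.inK_pow_eq hx le_rfl
  have hγ : conductorIdeal R K ≤ normalization R K :=
    (colon_toSubmodule_le _ _).trans (one_le_toSubmodule _)
  have hγΛ : blowupMod K I / normalization R K ≤ normalization R K :=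
    (colon_toSubmodule_le _ _).trans (Subalgebra.toSubmodule.monotone hN)
  rw [h.genus_eq (K := K) hI, h.idealMult_mul (K := K) hI, condLen, condLenBlowup,
    ← relLen_of_le hγ, ← relLen_of_le hγΛ, hpow]
  exact hω.two_mul_relLen_tfae hAG hres (h.blowupMod_ne_one hI hIprinc) hN (pow_ne_zero _ hx)
    (hpow ▸ inK_le_one _)

theorem IsMinimalReduction.conditionsA_of_starDual_eq (h : IsMinimalReduction I x) (hI : I ≠ ⊥)
    (hIprinc : ¬ Submodule.IsPrincipal I) (hω : IsNormalizedCanonicalIdeal R K ω)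
    (hAG : IsAlmostGorenstein R K) (hres : IsResiduallyRational R K)
    (hdual : starDual K (blowupMod K I) = inK K (I ^ reductionExponent I x)) :
    ConditionsA K I (reductionExponent I x) ω := by
  have hx := h.algebraMap_ne_zero (K := K) hI
  rw [h.inK_pow_eq hx le_rfl] at hdual
  exact h.conditionsA hI hω <| hω.mul_toSubmodule_of_starDual_eq hAG hres
    (h.blowupMod_ne_one hI hIprinc) (h.blowup_le_integralClosure hI) (pow_ne_zero _ hx) hdual

end AlmostGorensteinBlowup

end CurveBlowup

theorem theorem5p5_general {R : Type*} [CommRing R] [IsDomain R] [IsLocalRing R]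
    [IsNoetherianRing R] {K : Type*} [Field K] [Algebra R K] [IsFractionRing R K]
    [Module.Finite R (integralClosure R K)] [IsDiscreteValuationRing (integralClosure R K)]
    (hres : IsResiduallyRational R K) (hAG : IsAlmostGorenstein R K)
    (I : Ideal R) (hIprinc : ¬ Submodule.IsPrincipal I) :
    ((∀ n, hilbertFn I n ≠ ⊤) ∧ IsHPolynomial I (hPolynomial I) ∧
      cmType R K ≠ ⊤ ∧ condLen R K ≠ ⊤ ∧ condLenBlowup K I ≠ ⊤ ∧
      (∃ x, IsMinimalReduction I x) ∧ ∃ ω, IsNormalizedCanonicalIdeal R K ω) ∧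
    ∀ (x : R) (ω : Submodule R K) (ν : ℕ), IsMinimalReduction I x →
      IsNormalizedCanonicalIdeal R K ω → ν = reductionExponent I x →
      len (starDual K (blowupMod K I)) (inK K (I ^ ν)) ≠ ⊤ ∧
      len (starDual K (starDual K (blowupMod K I))) (blowupMod K I) ≠ ⊤ ∧
      2 * genus I = idealMult I * ν + (cmType R K).toNat - 1
        - (len (starDual K (blowupMod K I)) (inK K (I ^ ν))).toNat
        - (len (starDual K (starDual K (blowupMod K I))) (blowupMod K I)).toNat ∧
      2 * genus I ≤ idealMult I * ν + (cmType R K).toNat - 1 ∧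
      List.TFAE [
        2 * genus I = idealMult I * ν + (cmType R K).toNat - 1,
        IsGorenstein (blowup K I) K ∧
          ((condLen R K).toNat : ℤ) - (condLenBlowup K I).toNat = idealMult I * ν,
        1 / blowupMod K I = inK K (I ^ ν),
        ω / blowupMod K I = inK K (I ^ ν)] ∧
      (2 * genus I = idealMult I * ν + (cmType R K).toNat - 1 → ConditionsA K I ν ω) := by
  have : FaithfulSMul R (integralClosure R K) := inferInstance
  have : Ring.KrullDimLE 1 R := krullDimLE_one_of_isIntegral R (integralClosure R K)
  have hI : I ≠ ⊥ := fun h => hIprinc (h ▸ inferInstance)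
  obtain ⟨x₀, hx₀⟩ := exists_isMinimalReduction K hI
  have hΛ := hx₀.isNonzeroFractional_blowupMod (K := K) hI
  refine ⟨⟨hilbertFn_ne_top hI, hx₀.isHPolynomial_hPolynomial hI, cmType_ne_top hres,
    IsNonzeroFractional.one.len_normalization_colon_ne_top (one_le_toSubmodule _),
    hΛ.len_normalization_colon_ne_top (hx₀.blowup_le_integralClosure hI), ⟨x₀, hx₀⟩,
    exists_isNormalizedCanonicalIdeal hres⟩, ?_⟩
  rintro x ω _ hx hω rfl
  have hdual := IsNonzeroFractional.one.div hΛ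
  have hgenus := hx.two_mul_genus hI hIprinc hω hAG hres
  have htfae := hx.two_mul_genus_tfae hI hIprinc hω hAG hres
  exact ⟨hdual.len_ne_top (.inK (pow_ne_zero _ hI)) (hx.inK_pow_le_starDual hI),
    (IsNonzeroFractional.one.div hdual).len_ne_top hΛ (le_colon_colon _ _), hgenus, by linarith,
    htfae, fun h => hx.conditionsA_of_starDual_eq hI hIprinc hω hAG hres ((htfae.out 0 2).mp h)⟩

theorem theorem5p5 {R : Type*} [CommRing R] [IsDomain R] [IsLocalRing R] [IsNoetherianRing R]
    (hdim : ringKrullDim R = 1) [Infinite (IsLocalRing.ResidueField R)]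
    {K : Type*} [Field K] [Algebra R K] [IsFractionRing R K]
    [Module.Finite R (integralClosure R K)] [IsDiscreteValuationRing (integralClosure R K)]
    (hres : Function.Surjective ((IsLocalRing.residue (integralClosure R K)).comp
      (algebraMap R (integralClosure R K))))
    (hAG : IsAlmostGorenstein R K)
    (I : Ideal R) (hI : I.IsPrimary) (hIrad : I.radical = IsLocalRing.maximalIdeal R)
    (hIprinc : ¬ Submodule.IsPrincipal I) :
    -- the invariants are well defined, a minimal reduction and a canonical ideal exist
    ((∀ n, hilbertFn I n ≠ ⊤) ∧ IsHPolynomial I (hPolynomial I) ∧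
      cmType R K ≠ ⊤ ∧ condLen R K ≠ ⊤ ∧ condLenBlowup K I ≠ ⊤ ∧
      (∃ x, IsMinimalReduction I x) ∧ ∃ ω, IsNormalizedCanonicalIdeal R K ω) ∧
    ∀ (x : R) (ω : Submodule R K) (ν : ℕ), IsMinimalReduction I x →
      IsNormalizedCanonicalIdeal R K ω → ν = reductionExponent I x →
      len (starDual K (blowupMod K I)) (inK K (I ^ ν)) ≠ ⊤ ∧
      len (starDual K (starDual K (blowupMod K I))) (blowupMod K I) ≠ ⊤ ∧
      2 * genus I = idealMult I * ν + (cmType R K).toNat - 1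
        - (len (starDual K (blowupMod K I)) (inK K (I ^ ν))).toNat
        - (len (starDual K (starDual K (blowupMod K I))) (blowupMod K I)).toNat ∧
      2 * genus I ≤ idealMult I * ν + (cmType R K).toNat - 1 ∧
      List.TFAE [
        2 * genus I = idealMult I * ν + (cmType R K).toNat - 1,
        IsGorenstein (blowup K I) K ∧
          ((condLen R K).toNat : ℤ) - (condLenBlowup K I).toNat = idealMult I * ν,
        1 / blowupMod K I = inK K (I ^ ν),
        ω / blowupMod K I = inK K (I ^ ν)] ∧
      (2 * genus I = idealMult I * ν + (cmType R K).toNat - 1 → ConditionsA K I ν ω) :=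
  theorem5p5_general hres hAG I hIprinc
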